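/- **Setting.** Fix $d\ge 2$, $T\ge 1$ and a norm $\|\cdot\|$ on $\mathbb R^d$ with dual norm $\|\cdot\|_*$. Let $S\subseteq[0,1]^d$ be nonempty and convex, and let $f$ be concave and $L$-Lipschitz (for $\|\cdot\|$) on $[0,1]^d$, $L\ge 0$. The hidden input consists of $T$ sets $X_1,\dots,X_T\subseteq[0,1]^d$ such that some choice $v_i\in X_i$ has $\frac1T\sum_i v_i\in S$. They arrive in the uniformly random order $A_t=X_{\pi(t)}$ (random permutation model), and one vector $v_t^\dagger\in A_t$ has to be picked at each step $t$ before the later sets are seen. Write $v^\dagger_{avg}=\frac1T\sum_t v_t^\dagger$. Let $d(v,S)=\inf_{y\in S}\|v-y\|$, let $\mathrm{OPT}^\delta$ be the supremum of $f(\frac1T\sum_i v_i)$ over choices $v_i\in X_i$ with $d(\frac1T\sum_i v_i,S)\le\delta$, and let $\mathrm{OPT}$ be the same supremum with the constraint $\frac1T\sum_i v_i\in S$. A number $Z\ge0$ is given such that $\mathrm{OPT}^\delta\le \mathrm{OPT}+Z\delta$ for all $\delta\ge0$. **Algorithm.** Let $h_S(\theta)=\sup_{y\in S}\theta\cdot y$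 and $(-f)^*(\phi)=\sup_{y\in[0,1]^d}(y\cdot\phi+f(y))$. Two online convex optimization (OCO) learners produce $\theta_t\in W=\{\|\theta\|_*\le1\}$ and $\phi_t\in U=\{\|\phi\|_*\le L\}$; $\theta_t$ depends only on $g_1,\dots,g_{t-1}$ and $\phi_t$ only on $\psi_1,\dots,\psi_{t-1}$, where $g_t(\theta)=\theta\cdot v_t^\dagger-h_S(\theta)$ and $\psi_t(\phi)=\phi\cdot v_t^\dagger-(-f)^*(\phi)$. At step $t$ the algorithm picks $$v_t^\dagger\in\arg\max_{v\in A_t}\; -\phi_t\cdot v-2(Z+L)\,\theta_t\cdot v$$ (the maxima are assumed to be attained; ties are broken by any rule that depends only on what has been received so far). The regrets of the learners on this run are $\mathrm{Reg}=\sup_{\theta\in W}\sum_t g_t(\theta)-\sum_t g_t(\theta_t)$ and $\mathrm{Reg}'=\sup_{\phi\in U}\sum_t\psi_t(\phi)-\sum_t\psi_t(\phi_t)$. **Theorem.** There is a universal constant $K>0$ such that the following holds. (1) Suppose $\|x\|\le\|\mathbf 1_d\|\max_j|x_j|$ for all $x$ (as for every norm that is monotone in the absolute values of the coordinates). For arbitrary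 learners as above and any $\mathcal R(T)\ge \mathbb E[\mathrm{Reg}]$, $\mathcal R'(T)\ge\mathbb E[\mathrm{Reg}']$, $$\mathbb E[\mathrm{OPT}-f(v^\dagger_{avg})]\le\frac{Z+L}{T}\bigl(2\mathcal R(T)+K\mathcal Q(T)\bigr)+\frac{\mathcal R'(T)}{T},$$ and, if $Z+L>0$, $$\mathbb E[d(v^\dagger_{avg},S)]\le\frac1T\bigl(2\mathcal R(T)+K\mathcal Q(T)\bigr)+\frac{1}{Z+L}\cdot\frac{\mathcal R'(T)}{T}.$$ Here, with $s=\sup_{v\in S}\max_j v_j\le1$, $$\mathcal Q(T)=\|\mathbf 1_d\|\cdot\min\Bigl\{\sqrt{T\log d},\ \sqrt{sT\log d}+\log d\,\log(1+\log d)\Bigr\};$$ for the Euclidean norm the same bounds hold also with $\mathcal Q(T)=\|\mathbf 1_d\|\sqrt{sT\log d}$. (2) Let $\|\cdot\|$ be the Euclidean norm, with $C=d\log d$ and $D=d$, or the $L_\infty$ norm, with $C=D=\log d$. Then there are learners, depending only on $d,T,f,S,L$ and the norm, whose regrets for any $T$ vectors of $[0,1]^d$ in place of $v_1^\dagger,\dots,v_T^\dagger$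 are at most $K\sqrt{DT}$ and $KL\sqrt{DT}$ respectively, such that the algorithm run with them satisfies, for all $X_1,\dots,X_T$ and $Z$ as above, $$\mathbb E[\mathrm{OPT}-f(v^\dagger_{avg})]\le K(Z+L)\sqrt{C/T},\qquad\text{and, if } Z+L>0,\qquad \mathbb E[d(v^\dagger_{avg},S)]\le K\sqrt{C/T}.$$ -/

import Mathlib

noncomputable section

namespace OnlineCP

/-- Vectors of `ℝ^d`, as plain coordinate functions. The norm that measures distances is always
passed explicitly, as a `Seminorm` that is assumed to be definite. -/
abbrev Vec (d : ℕ) := Fin d → ℝ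

/-- The domain `[0,1]^d`. -/
def cube (d : ℕ) : Set (Vec d) := Set.Icc 0 1

/-- The Euclidean norm on `ℝ^d`. -/
def euclideanNorm (d : ℕ) : Seminorm ℝ (Vec d) :=
  (normSeminorm ℝ (EuclideanSpace ℝ (Fin d))).comp
    (WithLp.linearEquiv 2 ℝ (Fin d → ℝ)).symm.toLinearMap

/-- The `L_∞` norm on `ℝ^d`. -/
def supNorm (d : ℕ) : Seminorm ℝ (Vec d) := normSeminorm ℝ (Fin d → ℝ)

/-- The dual norm `‖θ‖_* = sup {x · θ : ‖x‖ ≤ 1}`. -/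
def dualNorm {d : ℕ} (N : Seminorm ℝ (Vec d)) (θ : Vec d) : ℝ :=
  sSup ((fun x => dotProduct x θ) '' {x | N x ≤ 1})

/-- The ball `{θ : ‖θ‖_* ≤ r}` of the dual norm. -/
def dualBall {d : ℕ} (N : Seminorm ℝ (Vec d)) (r : ℝ) : Set (Vec d) := {θ | dualNorm N θ ≤ r}

/-- The distance `d(x, S)` with respect to the norm `N`. -/
def distTo {d : ℕ} (N : Seminorm ℝ (Vec d)) (x : Vec d) (S : Set (Vec d)) : ℝ :=
  sInf ((fun y => N (x - y)) '' S)

/-- The support function `h_S(θ) = sup {θ · y : y ∈ S}`. -/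
def supportFn {d : ℕ} (S : Set (Vec d)) (θ : Vec d) : ℝ :=
  sSup ((fun y => dotProduct θ y) '' S)

/-- The Fenchel conjugate over the cube, `h^*(θ) = sup {y · θ - h(y) : y ∈ [0,1]^d}`. -/
def conjugate {d : ℕ} (h : Vec d → ℝ) (θ : Vec d) : ℝ :=
  sSup ((fun y => dotProduct y θ - h y) '' cube d)

/-! ### Online convex optimization -/

/-- A (deterministic) learner for online convex optimization: it maps the list of the payoff
functions revealed in the earlier rounds, most recent first, to its next decision. -/
abbrev Learner (d : ℕ) := List (Vec d → ℝ) → Vec d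

/-- The total payoff of a learner against a list of payoff functions (most recent first). -/
def learnerPayoff {d : ℕ} (A : Learner d) : List (Vec d → ℝ) → ℝ
  | [] => 0
  | g :: gs => learnerPayoff A gs + g (A gs)

/-- The regret: the best total payoff of a single decision of `W` minus that of the learner. -/
def ocoRegret {d : ℕ} (W : Set (Vec d)) (A : Learner d) (gs : List (Vec d → ℝ)) : ℝ :=
  sSup ((fun θ => (gs.map (fun g => g θ)).sum) '' W) - learnerPayoff A gs

/-! ### The online stochastic convex programming problem -/

/-- The initial input: a nonempty convex set `S ⊆ [0,1]^d` and an objective `f` that is concave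
and `L`-Lipschitz (for the norm `N`) on `[0,1]^d`. -/
structure IsProblem {d : ℕ} (N : Seminorm ℝ (Vec d)) (f : Vec d → ℝ) (S : Set (Vec d))
    (L : ℝ) : Prop where
  subset_cube : S ⊆ cube d
  nonempty : S.Nonempty
  convex : Convex ℝ S
  concave : ConcaveOn ℝ (cube d) f
  nonneg : 0 ≤ L
  lipschitz : ∀ x ∈ cube d, ∀ y ∈ cube d, |f x - f y| ≤ L * N (x - y)

/-- The average of `T` vectors. -/
def average {d T : ℕ} (v : Fin T → Vec d) : Vec d := (T : ℝ)⁻¹ • ∑ i, v i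

/-- The hidden input: `T` sets of options in `[0,1]^d` that admit a feasible choice. -/
structure IsInstance {d T : ℕ} (S : Set (Vec d)) (X : Fin T → Set (Vec d)) : Prop where
  subset_cube : ∀ i, X i ⊆ cube d
  feasible : ∃ v : Fin T → Vec d, (∀ i, v i ∈ X i) ∧ average v ∈ S

/-- The offline optimum `OPT`. -/
def offlineOpt {d T : ℕ} (f : Vec d → ℝ) (S : Set (Vec d)) (X : Fin T → Set (Vec d)) : ℝ :=
  sSup {r | ∃ v : Fin T → Vec d, (∀ i, v i ∈ X i) ∧ average v ∈ S ∧ r = f (average v)}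

/-- The optimum `OPT^δ` of the offline problem with the constraint relaxed to distance `δ`. -/
def relaxedOpt {d T : ℕ} (N : Seminorm ℝ (Vec d)) (f : Vec d → ℝ) (S : Set (Vec d))
    (X : Fin T → Set (Vec d)) (δ : ℝ) : ℝ :=
  sSup {r | ∃ v : Fin T → Vec d,
    (∀ i, v i ∈ X i) ∧ distTo N (average v) S ≤ δ ∧ r = f (average v)}

/-- `Z` bounds the trade-off between objective and constraint:
`OPT^δ ≤ OPT + Z δ` for all `δ ≥ 0`. -/
structure IsTradeoff {d T : ℕ} (N : Seminorm ℝ (Vec d)) (f : Vec d → ℝ) (S : Set (Vec d))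
    (X : Fin T → Set (Vec d)) (Z : ℝ) : Prop where
  nonneg : 0 ≤ Z
  bound : ∀ δ : ℝ, 0 ≤ δ → relaxedOpt N f S X δ ≤ offlineOpt f S X + Z * δ

/-- The coordinate-wise largest value that a vector of `S` takes. -/
def maxCoord {d : ℕ} (S : Set (Vec d)) : ℝ := sSup {r | ∃ v ∈ S, ∃ j, r = v j}

/-! ### The algorithm -/

/-- The payoff function `g_t(θ) = θ · v - h_S(θ)`, where `v` is the vector played. -/
def constraintPayoff {d : ℕ} (S : Set (Vec d)) (v : Vec d) : Vec d → ℝ :=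
  fun θ => dotProduct θ v - supportFn S θ

/-- The payoff function `ψ_t(φ) = φ · v - (-f)^*(φ)`, where `v` is the vector played. -/
def objectivePayoff {d : ℕ} (f : Vec d → ℝ) (v : Vec d) : Vec d → ℝ :=
  fun φ => dotProduct φ v - conjugate (fun y => -f y) φ

/-- An argmax rule, with an arbitrary non-anticipating way to break ties: `sel (A :: As) c`
is a maximizer of `c · v` over the current set `A`; `As` are the sets received before. -/
def IsArgmaxRule {d T : ℕ} (X : Fin T → Set (Vec d))
    (sel : List (Set (Vec d)) → Vec d → Vec d) : Prop :=
  ∀ (i : Fin T) (As : List (Set (Vec d))) (c : Vec d),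
    sel (X i :: As) c ∈ X i ∧ ∀ v ∈ X i, dotProduct c v ≤ dotProduct c (sel (X i :: As) c)

/-- The vectors played by the algorithm on a list of received sets (all lists have the most
recent item first). In each step `θ` and `φ` are the decisions of the two learners on the payoff
functions of the earlier steps, and the played vector is a maximizer of
`-φ · v - 2 (Z + L) θ · v` over the current set. -/
def plays {d : ℕ} (f : Vec d → ℝ) (S : Set (Vec d)) (L Z : ℝ) (A B : Learner d)
    (sel : List (Set (Vec d)) → Vec d → Vec d) : List (Set (Vec d)) → List (Vec d)
  | [] => []
  | Y :: Ys =>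
    let vs := plays f S L Z A B sel Ys
    let θ := A (vs.map (constraintPayoff S))
    let φ := B (vs.map (objectivePayoff f))
    sel (Y :: Ys) (-φ - (2 * (Z + L)) • θ) :: vs

/-- The vectors played when the sets arrive in the order `X (π 0), X (π 1), …`. -/
def playsOn {d T : ℕ} (f : Vec d → ℝ) (S : Set (Vec d)) (L Z : ℝ) (A B : Learner d)
    (sel : List (Set (Vec d)) → Vec d → Vec d) (X : Fin T → Set (Vec d))
    (π : Equiv.Perm (Fin T)) : List (Vec d) :=
  plays f S L Z A B sel (List.ofFn (fun t => X (π t))).reverse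

/-- The average of the vectors played in the `T` steps. -/
def playedAverage {d T : ℕ} (f : Vec d → ℝ) (S : Set (Vec d)) (L Z : ℝ) (A B : Learner d)
    (sel : List (Set (Vec d)) → Vec d → Vec d) (X : Fin T → Set (Vec d))
    (π : Equiv.Perm (Fin T)) : Vec d :=
  (T : ℝ)⁻¹ • (playsOn f S L Z A B sel X π).sum

/-! ### Expected regrets in the random permutation model -/

/-- Expectation over a uniformly random permutation. -/
def permExp {T : ℕ} (F : Equiv.Perm (Fin T) → ℝ) : ℝ :=
  (∑ π : Equiv.Perm (Fin T), F π) / (T.factorial : ℝ)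

/-- The expected objective regret `E[OPT - f(average)]`. -/
def objectiveRegret {d T : ℕ} (f : Vec d → ℝ) (S : Set (Vec d)) (L Z : ℝ) (A B : Learner d)
    (sel : List (Set (Vec d)) → Vec d → Vec d) (X : Fin T → Set (Vec d)) : ℝ :=
  permExp (fun π => offlineOpt f S X - f (playedAverage f S L Z A B sel X π))

/-- The expected constraint regret `E[d(average, S)]`. -/
def constraintRegret {d T : ℕ} (N : Seminorm ℝ (Vec d)) (f : Vec d → ℝ) (S : Set (Vec d))
    (L Z : ℝ) (A B : Learner d) (sel : List (Set (Vec d)) → Vec d → Vec d)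
    (X : Fin T → Set (Vec d)) : ℝ :=
  permExp (fun π => distTo N (playedAverage f S L Z A B sel X π) S)

/-- The expected regret of the learner `A` for `g_1, …, g_T` over `{θ : ‖θ‖_* ≤ 1}`. -/
def learnerRegretθ {d T : ℕ} (N : Seminorm ℝ (Vec d)) (f : Vec d → ℝ) (S : Set (Vec d))
    (L Z : ℝ) (A B : Learner d) (sel : List (Set (Vec d)) → Vec d → Vec d)
    (X : Fin T → Set (Vec d)) : ℝ :=
  permExp (fun π => ocoRegret (dualBall N 1) A
    ((playsOn f S L Z A B sel X π).map (constraintPayoff S)))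

/-- The expected regret of the learner `B` for `ψ_1, …, ψ_T` over `{φ : ‖φ‖_* ≤ L}`. -/
def learnerRegretφ {d T : ℕ} (N : Seminorm ℝ (Vec d)) (f : Vec d → ℝ) (S : Set (Vec d))
    (L Z : ℝ) (A B : Learner d) (sel : List (Set (Vec d)) → Vec d → Vec d)
    (X : Fin T → Set (Vec d)) : ℝ :=
  permExp (fun π => ocoRegret (dualBall N L) B
    ((playsOn f S L Z A B sel X π).map (objectivePayoff f)))

end OnlineCP

end

noncomputable section

namespace OnlineCP

open Finset

/-! ### Duality for norms on `ℝ^d` -/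

/-! Both quantities to be bounded are maxima of the learners' payoffs. By duality, `d(v, S)` is the
maximum of `θ · v - h_S(θ)` over the dual unit ball, and `-f(v)` is the maximum of `φ · v -
(-f)^*(φ)` over the dual ball of radius `L` (`exists_distTo_le`, `IsProblem.exists_neg_le`, both
from the Hahn–Banach argument in `exists_dual_supergradient`). Hence `T d(v_avg, S)` and `-T
f(v_avg)` are at most regret plus payoff of the respective learner.

The payoffs, weighted by `1` and `2(Z+L)`, are compared with a nearly optimal feasible choice `w`
(`learnerPayoff_add_le`). The argmax rule lets `w_{π(t)}` replace the played vector. If it were the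
average of `w`, which lies in `S`, the payoff would be at most `-f(average w)` per step. The
remaining error is the sum of `(w_{π(t)} - average w) · c_t`, where `c_t` has dual norm at most
`3(Z+L)` and depends only on the past. By exchangeability `w_{π(t)}` may be replaced here by the
mean of all vectors not yet seen, so step `t` costs at most `3(Z+L)` times the mean deviation of the
suffix (`permExp_stepSum_le`).

Maclaurin's inequality bounds the exponential moments of sums sampled without replacement by Poisson
ones (`permExp_prod_le`, `permExp_exp_le`). A union bound over the coordinates and a sum over all
suffix lengths give `Q` (`sum_le_of_bennett`). For the Euclidean norm variances suffice.

This bounds `E[OPT - f] + 2(Z+L) E[d]`. Since `E[OPT - f] ≥ -Z E[d]` by the trade-off assumption,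
`regret_le` separates the two terms. For the explicit rates, payoffs are linearized by
supergradients in `[-1,1]^d`, against which projected gradient ascent (Euclidean norm) or
exponentiated gradient (`L_∞` norm) is played. -/

lemma exists_norm_le_mul {d : ℕ} (N : Seminorm ℝ (Vec d)) (hN : ∀ x, N x = 0 → x = 0) :
    ∃ C : ℝ, 0 ≤ C ∧ ∀ x, ‖x‖ ≤ C * N x := by
  have hcont : Continuous N := by
    rw [← continuousOn_univ]
    exact N.convexOn.continuousOn isOpen_univ
  rcases (Metric.sphere (0 : Vec d) 1).eq_empty_or_nonempty with h | h
  · refine ⟨0, le_rfl, fun x => ?_⟩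
    by_contra hx
    have hx' : ‖x‖ ≠ 0 := fun h0 => hx (by simp [h0])
    have : (‖x‖⁻¹ • x) ∈ Metric.sphere (0 : Vec d) 1 := by
      simp [norm_smul, hx']
    simp [h] at this
  · obtain ⟨u, hu, hmin⟩ := (isCompact_sphere (0 : Vec d) 1).exists_isMinOn h hcont.continuousOn
    have hu0 : 0 < N u := by
      refine lt_of_le_of_ne (apply_nonneg N u) fun h0 => ?_
      have := hN u h0.symm
      simp [this] at hu
    refine ⟨(N u)⁻¹, by positivity, fun x => ?_⟩
    by_cases hx : ‖x‖ = 0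
    · rw [hx]; positivity
    have hmem : (‖x‖⁻¹ • x) ∈ Metric.sphere (0 : Vec d) 1 := by
      simp [norm_smul, hx]
    have h1 : N u ≤ N (‖x‖⁻¹ • x) := hmin hmem
    rw [map_smul_eq_mul, norm_inv, norm_norm] at h1
    have hx0 : 0 < ‖x‖ := lt_of_le_of_ne (norm_nonneg _) (Ne.symm hx)
    rw [inv_mul_eq_div, le_div_iff₀ hx0] at h1
    rw [inv_mul_eq_div, le_div_iff₀ hu0]
    linarith

lemma abs_dotProduct_le {d : ℕ} (x y : Vec d) : |x ⬝ᵥ y| ≤ ‖x‖ * ∑ j, |y j| := by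
  rw [dotProduct, mul_sum]
  refine (abs_sum_le_sum_abs _ _).trans (sum_le_sum fun j _ => ?_)
  rw [abs_mul]
  exact mul_le_mul_of_nonneg_right (norm_le_pi_norm x j) (abs_nonneg _)

lemma bddAbove_dualNorm {d : ℕ} (N : Seminorm ℝ (Vec d)) (hN : ∀ x, N x = 0 → x = 0)
    (θ : Vec d) : BddAbove ((fun x => x ⬝ᵥ θ) '' {x | N x ≤ 1}) := by
  obtain ⟨C, hC, h⟩ := exists_norm_le_mul N hN
  refine ⟨C * ∑ j, |θ j|, ?_⟩
  rintro _ ⟨x, hx, rfl⟩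
  refine (le_abs_self _).trans ((abs_dotProduct_le x θ).trans ?_)
  refine mul_le_mul_of_nonneg_right ((h x).trans ?_) (sum_nonneg fun _ _ => abs_nonneg _)
  have : N x ≤ 1 := hx
  nlinarith

lemma mem_dualBall_iff {d : ℕ} {N : Seminorm ℝ (Vec d)} (hN : ∀ x, N x = 0 → x = 0)
    {r : ℝ} (hr : 0 ≤ r) {θ : Vec d} :
    θ ∈ dualBall N r ↔ ∀ x, x ⬝ᵥ θ ≤ r * N x := by
  constructor
  · intro h x
    have hθ : dualNorm N θ ≤ r := h
    rcases eq_or_lt_of_le (apply_nonneg N x) with h0 | h0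
    · rw [hN x h0.symm]; simp
    · have h1 : ((N x)⁻¹ • x) ⬝ᵥ θ ≤ dualNorm N θ := by
        refine le_csSup (bddAbove_dualNorm N hN θ) ⟨(N x)⁻¹ • x, ?_, rfl⟩
        change N _ ≤ 1
        rw [map_smul_eq_mul, norm_inv, Real.norm_of_nonneg h0.le, inv_mul_cancel₀ h0.ne']
      rw [smul_dotProduct, smul_eq_mul, inv_mul_eq_div, div_le_iff₀ h0] at h1
      exact h1.trans (mul_le_mul_of_nonneg_right hθ h0.le)
  · intro h
    change sSup ((fun x => x ⬝ᵥ θ) '' {x | N x ≤ 1}) ≤ r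
    refine csSup_le ⟨_, Set.mem_image_of_mem _ (by simp : N 0 ≤ 1)⟩ ?_
    rintro _ ⟨x, hx, rfl⟩
    have hx' : N x ≤ 1 := hx
    exact (h x).trans (by nlinarith)

lemma zero_mem_dualBall {d : ℕ} {N : Seminorm ℝ (Vec d)} {r : ℝ} (hr : 0 ≤ r) :
    (0 : Vec d) ∈ dualBall N r := by
  change sSup ((fun x => x ⬝ᵥ (0 : Vec d)) '' {x | N x ≤ 1}) ≤ r
  refine csSup_le ⟨_, Set.mem_image_of_mem _ (by simp : N 0 ≤ 1)⟩ ?_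
  rintro _ ⟨x, -, rfl⟩
  simpa using hr

/-- A concave function that is `L`-Lipschitz on a convex set `K` has at each point of `K` a
supergradient (with the opposite sign) of dual norm at most `L`. -/
lemma exists_dual_supergradient {d : ℕ} (N : Seminorm ℝ (Vec d)) {K : Set (Vec d)}
    {h : Vec d → ℝ} {L : ℝ} (hL : 0 ≤ L) (hc : ConcaveOn ℝ K h)
    (hlip : ∀ x ∈ K, ∀ y ∈ K, h x - h y ≤ L * N (x - y)) {v : Vec d} (hv : v ∈ K) :
    ∃ φ : Vec d, (∀ x, x ⬝ᵥ φ ≤ L * N x) ∧ ∀ y ∈ K, φ ⬝ᵥ y + h y ≤ φ ⬝ᵥ v + h v := by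
  -- The infimum `p` of `V x` is the largest sublinear function below both `L * N` and the map `y -
  -- v ↦ h v - h y` for `y ∈ K`. A linear `g ≤ p` satisfies both required inequalities: `l = 0`
  -- gives the norm bound, `l = 1` the supergradient inequality.
  let V : Vec d → Set ℝ := fun x =>
    {r | ∃ l : ℝ, 0 ≤ l ∧ ∃ y ∈ K, r = L * N (x - l • (y - v)) + l * (h v - h y)}
  let p : Vec d → ℝ := fun x => sInf (V x)
  -- The Lipschitz condition is what keeps `p` finite.
  have hlow : ∀ x, ∀ r ∈ V x, -(L * N x) ≤ r := by
    rintro x _ ⟨l, hl, y, hy, rfl⟩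
    have h1 := hlip y hy v hv
    have h2 : N (l • (y - v)) = l * N (y - v) := by
      rw [map_smul_eq_mul, Real.norm_of_nonneg hl]
    have h3 : N (l • (y - v)) ≤ N x + N (x - l • (y - v)) := by
      have := map_sub_le_add N x (x - l • (y - v))
      simpa using this
    have h4 := mul_le_mul_of_nonneg_left h1 hl
    have h5 := mul_le_mul_of_nonneg_left h3 hL
    rw [h2] at h5
    nlinarith
  have hbdd : ∀ x, BddBelow (V x) := fun x => ⟨_, fun r hr => hlow x r hr⟩
  have hne : ∀ x, (V x).Nonempty := fun x => ⟨_, 0, le_rfl, v, hv, rfl⟩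
  have hhom_le : ∀ c : ℝ, 0 < c → ∀ x, p (c • x) ≤ c * p x := by
    intro c hc0 x
    rw [← div_le_iff₀' hc0]
    refine le_csInf (hne x) ?_
    rintro _ ⟨l, hl, y, hy, rfl⟩
    rw [div_le_iff₀' hc0]
    refine csInf_le (hbdd _) ⟨c * l, by positivity, y, hy, ?_⟩
    have : c • x - (c * l) • (y - v) = c • (x - l • (y - v)) := by
      rw [smul_sub c, mul_smul]
    rw [this, map_smul_eq_mul, Real.norm_of_nonneg hc0.le]
    ring
  have hhom : ∀ c : ℝ, 0 < c → ∀ x, p (c • x) = c * p x := by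
    intro c hc0 x
    refine le_antisymm (hhom_le c hc0 x) ?_
    have := hhom_le c⁻¹ (by positivity) (c • x)
    rw [smul_smul, inv_mul_cancel₀ hc0.ne', one_smul, inv_mul_eq_div, le_div_iff₀ hc0] at this
    linarith
  have hadd : ∀ x y, p (x + y) ≤ p x + p y := by
    intro x x'
    rw [← sub_le_iff_le_add]
    refine le_csInf (hne x) ?_
    rintro _ ⟨l, hl, y, hy, rfl⟩
    rw [sub_le_comm]
    refine le_csInf (hne x') ?_
    rintro _ ⟨l', hl', y', hy', rfl⟩
    rw [sub_le_iff_le_add]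
    -- Subadditivity is concavity of `h`: `z` is the convex combination of `y` and `y'` with weights
    -- proportional to `l` and `l'`. If both vanish, `v` itself serves.
    have key : ∃ z ∈ K, l • (y - v) + l' • (y' - v) = (l + l') • (z - v) ∧
        (l + l') * (h v - h z) ≤ l * (h v - h y) + l' * (h v - h y') := by
      rcases eq_or_lt_of_le (add_nonneg hl hl') with h0 | h0
      · have e1 : l = 0 := by linarith
        have e2 : l' = 0 := by linarith
        exact ⟨v, hv, by simp [e1, e2], by simp [e1, e2]⟩
      · have hs : l / (l + l') + l' / (l + l') = 1 := by field_simp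
        have hz := hc.1 hy hy' (by positivity : 0 ≤ l / (l + l'))
          (by positivity : 0 ≤ l' / (l + l')) hs
        have hz2 := hc.2 hy hy' (by positivity : 0 ≤ l / (l + l'))
          (by positivity : 0 ≤ l' / (l + l')) hs
        refine ⟨_, hz, ?_, ?_⟩
        · ext j
          simp only [Pi.add_apply, Pi.smul_apply, Pi.sub_apply, smul_eq_mul]
          field_simp
          ring
        · have h7 := mul_le_mul_of_nonneg_left hz2 h0.le
          have h8 : (l + l') * ((l / (l + l')) • h y + (l' / (l + l')) • h y') =
              l * h y + l' * h y' := by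
            simp only [smul_eq_mul]
            field_simp
          rw [h8] at h7
          linarith
    obtain ⟨z, hz, e1, e2⟩ := key
    have h3 : p (x + x') ≤ L * N (x + x' - (l + l') • (z - v)) + (l + l') * (h v - h z) :=
      csInf_le (hbdd _) ⟨l + l', add_nonneg hl hl', z, hz, rfl⟩
    have h4 : x + x' - (l + l') • (z - v) = (x - l • (y - v)) + (x' - l' • (y' - v)) := by
      rw [← e1]; abel
    rw [h4] at h3
    have h5 := mul_le_mul_of_nonneg_left
      (map_add_le_add N (x - l • (y - v)) (x' - l' • (y' - v))) hL
    linarith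
  -- Hahn–Banach from the zero subspace, where only `0 ≤ p 0` has to be checked.
  obtain ⟨g, -, hg⟩ := exists_extension_of_le_sublinear (⟨⊥, 0⟩ : (Vec d) →ₗ.[ℝ] ℝ) p hhom hadd (by
    rintro ⟨x, hx⟩
    have hx' : x = 0 := by simpa using hx
    subst hx'
    refine le_csInf (hne 0) fun r hr => ?_
    simpa using hlow 0 r hr)
  let φ : Vec d := fun j => g (Pi.single j 1)
  have hφ : ∀ x, x ⬝ᵥ φ = g x := by
    intro x
    conv_rhs => rw [← Finset.univ_sum_single x]
    rw [map_sum, dotProduct]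
    refine sum_congr rfl fun j _ => ?_
    have : (Pi.single j (x j) : Vec d) = x j • Pi.single j 1 := by
      rw [← Pi.single_smul]; simp
    rw [this, map_smul, smul_eq_mul]
  refine ⟨φ, fun x => ?_, fun y hy => ?_⟩
  · rw [hφ]
    refine (hg x).trans (csInf_le (hbdd x) ⟨0, le_rfl, v, hv, by simp⟩)
  · have h1 : g (y - v) ≤ h v - h y :=
      (hg _).trans (csInf_le (hbdd _) ⟨1, zero_le_one, y, hy, by simp⟩)
    rw [dotProduct_comm φ y, dotProduct_comm φ v, hφ, hφ]
    rw [map_sub] at h1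
    linarith

/-! ### The cube, distances and support functions -/

lemma norm_le_one_of_mem_cube {d : ℕ} {x : Vec d} (hx : x ∈ cube d) : ‖x‖ ≤ 1 := by
  rw [pi_norm_le_iff_of_nonneg zero_le_one]
  intro j
  rw [Real.norm_of_nonneg (hx.1 j)]
  exact hx.2 j

lemma abs_sub_le_one_of_mem_cube {d : ℕ} {x y : Vec d} (hx : x ∈ cube d) (hy : y ∈ cube d)
    (j : Fin d) : |x j - y j| ≤ 1 := by
  have h1 := hx.1 j
  have h2 := hx.2 j
  have h3 := hy.1 j
  have h4 := hy.2 j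
  simp only [Pi.zero_apply, Pi.one_apply] at h1 h2 h3 h4
  rw [abs_le]
  constructor <;> linarith

lemma bddAbove_supportFn {d : ℕ} {S : Set (Vec d)} (hS : S ⊆ cube d) (θ : Vec d) :
    BddAbove ((fun y => θ ⬝ᵥ y) '' S) := by
  refine ⟨∑ j, |θ j|, ?_⟩
  rintro _ ⟨y, hy, rfl⟩
  simp only
  rw [dotProduct_comm]
  refine (le_abs_self _).trans ((abs_dotProduct_le y θ).trans ?_)
  have := norm_le_one_of_mem_cube (hS hy)
  exact mul_le_of_le_one_left (sum_nonneg fun _ _ => abs_nonneg _) this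

lemma dotProduct_le_supportFn {d : ℕ} {S : Set (Vec d)} (hS : S ⊆ cube d) {y : Vec d}
    (hy : y ∈ S) (θ : Vec d) : θ ⬝ᵥ y ≤ supportFn S θ :=
  le_csSup (bddAbove_supportFn hS θ) ⟨y, hy, rfl⟩

lemma seminorm_le_sum {d : ℕ} (N : Seminorm ℝ (Vec d)) (x : Vec d) :
    N x ≤ ‖x‖ * ∑ j, N (Pi.single j 1) := by
  conv_lhs => rw [← Finset.univ_sum_single x]
  rw [mul_sum]
  refine (Finset.le_sum_of_subadditive N (map_zero N).le (map_add_le_add N) _ _).trans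
    (sum_le_sum fun j _ => ?_)
  have : (Pi.single j (x j) : Vec d) = x j • Pi.single j 1 := by
    rw [← Pi.single_smul]; simp
  rw [this, map_smul_eq_mul]
  exact mul_le_mul_of_nonneg_right (norm_le_pi_norm x j) (apply_nonneg _ _)

lemma IsProblem.bddAbove {d : ℕ} {N : Seminorm ℝ (Vec d)} {f : Vec d → ℝ} {S : Set (Vec d)}
    {L : ℝ} (hp : IsProblem N f S L) : ∃ C : ℝ, ∀ x ∈ cube d, |f x| ≤ C := by
  have h0 : (0 : Vec d) ∈ cube d := ⟨le_rfl, zero_le_one⟩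
  refine ⟨|f 0| + L * (1 * ∑ j, N (Pi.single j 1)), fun x hx => ?_⟩
  have h1 := hp.lipschitz x hx 0 h0
  have h2 : N (x - 0) ≤ 1 * ∑ j, N (Pi.single j 1) := by
    rw [sub_zero]
    exact (seminorm_le_sum N x).trans (mul_le_mul_of_nonneg_right (norm_le_one_of_mem_cube hx)
      (sum_nonneg fun _ _ => apply_nonneg _ _))
  have h3 := mul_le_mul_of_nonneg_left h2 hp.nonneg
  have h4 : |f x| ≤ |f 0| + |f x - f 0| := by
    have := abs_add_le (f 0) (f x - f 0)
    simpa using this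
  linarith

lemma bddAbove_conjugate {d : ℕ} {h : Vec d → ℝ} {C : ℝ} (hC : ∀ x ∈ cube d, |h x| ≤ C)
    (φ : Vec d) : BddAbove ((fun y => y ⬝ᵥ φ - h y) '' cube d) := by
  refine ⟨∑ j, |φ j| + C, ?_⟩
  rintro _ ⟨y, hy, rfl⟩
  have h1 := (le_abs_self _).trans (abs_dotProduct_le y φ)
  have h2 : ‖y‖ * ∑ j, |φ j| ≤ ∑ j, |φ j| :=
    mul_le_of_le_one_left (sum_nonneg fun _ _ => abs_nonneg _) (norm_le_one_of_mem_cube hy)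
  have h3 := neg_le_of_abs_le (hC y hy)
  simp only
  linarith

/-- The Fenchel–Young inequality; boundedness of `f` on the cube makes the supremum a genuine one.
-/
lemma IsProblem.le_conjugate {d : ℕ} {N : Seminorm ℝ (Vec d)} {f : Vec d → ℝ} {S : Set (Vec d)}
    {L : ℝ} (hp : IsProblem N f S L) {y : Vec d} (hy : y ∈ cube d) (φ : Vec d) :
    φ ⬝ᵥ y + f y ≤ conjugate (fun y => -f y) φ := by
  obtain ⟨C, hC⟩ := hp.bddAbove
  have := le_csSup (bddAbove_conjugate (h := fun y => -f y) (C := C) (by simpa using hC) φ)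
    ⟨y, hy, rfl⟩
  rw [dotProduct_comm, ← sub_neg_eq_add]
  exact this

lemma distTo_nonneg {d : ℕ} (N : Seminorm ℝ (Vec d)) (x : Vec d) (S : Set (Vec d)) :
    0 ≤ distTo N x S := by
  refine Real.sInf_nonneg ?_
  rintro _ ⟨y, -, rfl⟩
  exact apply_nonneg _ _

lemma distTo_le {d : ℕ} (N : Seminorm ℝ (Vec d)) (x : Vec d) {S : Set (Vec d)} {y : Vec d}
    (hy : y ∈ S) : distTo N x S ≤ N (x - y) :=
  csInf_le ⟨0, by rintro _ ⟨z, -, rfl⟩; exact apply_nonneg _ _⟩ ⟨y, hy, rfl⟩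

lemma distTo_eq_zero {d : ℕ} (N : Seminorm ℝ (Vec d)) {x : Vec d} {S : Set (Vec d)}
    (hx : x ∈ S) : distTo N x S = 0 :=
  le_antisymm (by simpa using distTo_le N x hx) (distTo_nonneg N x S)

lemma distTo_sub_le {d : ℕ} (N : Seminorm ℝ (Vec d)) {S : Set (Vec d)} (hS : S.Nonempty)
    (x y : Vec d) : distTo N x S - distTo N y S ≤ N (x - y) := by
  rw [sub_le_comm]
  refine le_csInf (hS.image _) ?_
  rintro _ ⟨z, hz, rfl⟩
  have h1 := distTo_le N x hz
  have h2 := map_add_le_add N (x - y) (y - z)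
  rw [sub_add_sub_cancel] at h2
  simp only
  linarith

lemma convexOn_distTo {d : ℕ} (N : Seminorm ℝ (Vec d)) {S : Set (Vec d)} (hS : S.Nonempty)
    (hc : Convex ℝ S) : ConvexOn ℝ Set.univ (fun x => distTo N x S) := by
  refine ⟨convex_univ, fun x _ y _ a b ha hb hab => ?_⟩
  refine le_of_forall_pos_le_add fun ε hε => ?_
  -- `S` need not be closed, so nearest points are replaced by `ε`-nearest ones.
  obtain ⟨_, ⟨z, hz, rfl⟩, h1⟩ := exists_lt_of_csInf_lt (hS.image _)
    (lt_add_of_pos_right (distTo N x S) hε)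
  obtain ⟨_, ⟨w, hw, rfl⟩, h2⟩ := exists_lt_of_csInf_lt (hS.image _)
    (lt_add_of_pos_right (distTo N y S) hε)
  have h3 := distTo_le N (a • x + b • y) (hc hz hw ha hb hab)
  have h4 : a • x + b • y - (a • z + b • w) = a • (x - z) + b • (y - w) := by
    rw [smul_sub, smul_sub]; abel
  have h5 := map_add_le_add N (a • (x - z)) (b • (y - w))
  rw [map_smul_eq_mul, map_smul_eq_mul, Real.norm_of_nonneg ha, Real.norm_of_nonneg hb] at h5
  rw [h4] at h3
  have h6 := mul_le_mul_of_nonneg_left h1.le ha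
  have h7 := mul_le_mul_of_nonneg_left h2.le hb
  have h8 : a * ε + b * ε = ε := by rw [← add_mul, hab, one_mul]
  simp only [smul_eq_mul] at *
  linarith

/-- The distance to `S` is at most the largest value of `θ · v - h_S(θ)` on the dual ball. -/
lemma exists_distTo_le {d : ℕ} {N : Seminorm ℝ (Vec d)} {S : Set (Vec d)}
    (hS : S.Nonempty) (hc : Convex ℝ S) (v : Vec d) :
    ∃ θ : Vec d, (∀ x, x ⬝ᵥ θ ≤ 1 * N x) ∧ distTo N v S ≤ θ ⬝ᵥ v - supportFn S θ := by
  -- The distance is convex and `1`-Lipschitz and vanishes on `S`, so a subgradient at `v` separates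
  -- `v` from `S` by the full distance.
  obtain ⟨θ, h1, h2⟩ := exists_dual_supergradient N (K := Set.univ)
    (h := fun x => -distTo N x S) zero_le_one (convexOn_distTo N hS hc).neg
    (fun x _ y _ => by
      have := distTo_sub_le N hS y x
      rw [← neg_sub x y, map_neg_eq_map] at this
      linarith) (Set.mem_univ v)
  refine ⟨θ, h1, ?_⟩
  rw [le_sub_comm]
  refine csSup_le (hS.image _) ?_
  rintro _ ⟨y, hy, rfl⟩
  have h3 := h2 y (Set.mem_univ y)
  rw [distTo_eq_zero N hy] at h3
  linarith

/-- The biconjugate of `-f` on the dual ball of radius `L` is at least `-f`. -/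
lemma IsProblem.exists_neg_le {d : ℕ} {N : Seminorm ℝ (Vec d)} {f : Vec d → ℝ}
    {S : Set (Vec d)} {L : ℝ} (hp : IsProblem N f S L) {v : Vec d} (hv : v ∈ cube d) :
    ∃ φ : Vec d, (∀ x, x ⬝ᵥ φ ≤ L * N x) ∧
      -f v ≤ φ ⬝ᵥ v - conjugate (fun y => -f y) φ := by
  obtain ⟨φ, h1, h2⟩ := exists_dual_supergradient N hp.nonneg hp.concave
    (fun x hx y hy => (le_abs_self _).trans (hp.lipschitz x hx y hy)) hv
  refine ⟨φ, h1, ?_⟩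
  rw [le_sub_comm]
  refine csSup_le (Set.Nonempty.image _ ⟨v, hv⟩) ?_
  rintro _ ⟨y, hy, rfl⟩
  have h3 := h2 y hy
  simp only [dotProduct_comm y φ]
  linarith

/-! ### Uniformly random permutations -/

section permExp

variable {T : ℕ}

lemma permExp_const (c : ℝ) : permExp (fun _ : Equiv.Perm (Fin T) => c) = c := by
  have h : (T.factorial : ℝ) ≠ 0 := by positivity
  simp only [permExp, sum_const, card_univ, Fintype.card_perm, Fintype.card_fin, nsmul_eq_mul]
  field_simp

lemma permExp_mono {F G : Equiv.Perm (Fin T) → ℝ} (h : ∀ π, F π ≤ G π) :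
    permExp F ≤ permExp G :=
  div_le_div_of_nonneg_right (sum_le_sum fun π _ => h π) (by positivity)

lemma permExp_nonneg {F : Equiv.Perm (Fin T) → ℝ} (h : ∀ π, 0 ≤ F π) : 0 ≤ permExp F :=
  div_nonneg (sum_nonneg fun π _ => h π) (by positivity)

lemma permExp_add (F G : Equiv.Perm (Fin T) → ℝ) :
    permExp (fun π => F π + G π) = permExp F + permExp G := by
  simp only [permExp, sum_add_distrib, add_div]

lemma permExp_sub (F G : Equiv.Perm (Fin T) → ℝ) :
    permExp (fun π => F π - G π) = permExp F - permExp G := by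
  simp only [permExp, sum_sub_distrib, sub_div]

lemma permExp_mul_left (c : ℝ) (F : Equiv.Perm (Fin T) → ℝ) :
    permExp (fun π => c * F π) = c * permExp F := by
  simp only [permExp, ← mul_sum, mul_div_assoc]

lemma permExp_mul_const (c : ℝ) (F : Equiv.Perm (Fin T) → ℝ) :
    permExp (fun π => F π * c) = permExp F * c := by
  simp only [mul_comm _ c, permExp_mul_left]

lemma permExp_sum {ι : Type*} (s : Finset ι) (F : ι → Equiv.Perm (Fin T) → ℝ) :
    permExp (fun π => ∑ i ∈ s, F i π) = ∑ i ∈ s, permExp (F i) := by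
  simp only [permExp]
  rw [sum_comm, sum_div]

lemma permExp_comp_mul (σ : Equiv.Perm (Fin T)) (F : Equiv.Perm (Fin T) → ℝ) :
    permExp (fun π => F (π * σ)) = permExp F := by
  simp only [permExp]
  congr 1
  exact Equiv.sum_comp (Equiv.mulRight σ) F

lemma permExp_apply (hT : 1 ≤ T) (y : Fin T → ℝ) (i : Fin T) :
    permExp (fun π => y (π i)) = (∑ k, y k) / T := by
  have h : ∀ k, permExp (fun π => y (π k)) = permExp (fun π => y (π i)) := fun k => by
    rw [← permExp_comp_mul (Equiv.swap i k)]
    simp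
  have h1 : ∑ k, permExp (fun π : Equiv.Perm (Fin T) => y (π k)) = ∑ k, y k := by
    rw [← permExp_sum]
    simp only [Equiv.sum_comp _ y, permExp_const]
  simp only [h, sum_const, card_univ, Fintype.card_fin, nsmul_eq_mul] at h1
  have hT' : (T : ℝ) ≠ 0 := by positivity
  rw [← h1]
  field_simp

/-! ### Moments of sums sampled without replacement. -/

lemma prod_swap_of_notMem {M : Finset (Fin T)} {a k : Fin T} (ha : a ∉ M) (hk : k ∉ M)
    (y : Fin T → ℝ) (π : Equiv.Perm (Fin T)) :
    ∏ l ∈ M, y ((π * Equiv.swap a k) l) = ∏ l ∈ M, y (π l) := by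
  refine prod_congr rfl fun l hl => ?_
  rw [Equiv.Perm.mul_apply, Equiv.swap_apply_of_ne_of_ne]
  · rintro rfl; exact ha hl
  · rintro rfl; exact hk hl

/-- Maclaurin's inequality, in the form of sampling without replacement. -/
lemma permExp_prod_le (hT : 1 ≤ T) {y : Fin T → ℝ} (hy : ∀ i, 0 ≤ y i) (M : Finset (Fin T)) :
    permExp (fun π => ∏ k ∈ M, y (π k)) ≤ ((∑ i, y i) / T) ^ #M := by
  classical
  have hmean : 0 ≤ (∑ i, y i) / T := div_nonneg (sum_nonneg fun i _ => hy i) (by positivity)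
  induction M using Finset.induction_on with
  | empty => simp [permExp_const]
  | insert a M ha ih =>
    -- Position `a` is unused by the product, so its factor is, in the mean, at most that of any
    -- position `k`: equal by symmetry if `k ∉ M`, smaller if `k ∈ M`, where the value is already
    -- favoured. Summing over `k` turns the right side into the mean product times the sum of all
    -- values.
    have key : ∀ k, permExp (fun π => (∏ l ∈ M, y (π l)) * y (π a)) ≤
        permExp (fun π => (∏ l ∈ M, y (π l)) * y (π k)) := by
      intro k
      by_cases hk : k ∈ M
      · obtain ⟨M', hk', rfl⟩ : ∃ M', k ∉ M' ∧ M = insert k M' :=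
          ⟨M.erase k, notMem_erase k M, (insert_erase hk).symm⟩
        have ha' : a ∉ M' := fun h => ha (mem_insert_of_mem h)
        rw [← sub_nonneg, ← permExp_sub]
        -- Symmetrization under the swap of `a` and `k`: twice the difference is the mean of a
        -- nonnegative product times `(y (π k) - y (π a)) ^ 2`.
        have e1 : permExp (fun π => (∏ l ∈ M', y (π l)) * (y (π k) * (y (π k) - y (π a)))) =
            permExp (fun π => (∏ l ∈ M', y (π l)) * (y (π a) * (y (π a) - y (π k)))) := by
          rw [← permExp_comp_mul (Equiv.swap a k)]
          simp only [prod_swap_of_notMem ha' hk']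
          simp
        have e2 : permExp (fun π => (∏ l ∈ insert k M', y (π l)) * y (π k) -
            (∏ l ∈ insert k M', y (π l)) * y (π a)) =
            permExp (fun π => (∏ l ∈ M', y (π l)) * (y (π k) * (y (π k) - y (π a)))) := by
          simp only [prod_insert hk']
          congr 1; ext π; ring
        have e3 : 0 ≤ permExp (fun π => (∏ l ∈ M', y (π l)) * (y (π k) - y (π a)) ^ 2) :=
          permExp_nonneg fun π => mul_nonneg (prod_nonneg fun l _ => hy _) (sq_nonneg _)
        have e4 : permExp (fun π => (∏ l ∈ M', y (π l)) * (y (π k) - y (π a)) ^ 2) =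
            permExp (fun π => (∏ l ∈ M', y (π l)) * (y (π k) * (y (π k) - y (π a)))) +
            permExp (fun π => (∏ l ∈ M', y (π l)) * (y (π a) * (y (π a) - y (π k)))) := by
          rw [← permExp_add]
          congr 1; ext π; ring
        rw [e2]
        linarith
      · rw [← permExp_comp_mul (Equiv.swap a k)]
        simp only [prod_swap_of_notMem ha hk]
        simp
    have hsum := sum_le_sum fun k (_ : k ∈ (univ : Finset (Fin T))) => key k
    have hR : ∑ k, permExp (fun π => (∏ l ∈ M, y (π l)) * y (π k)) =
        permExp (fun π => ∏ l ∈ M, y (π l)) * ∑ i, y i := by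
      rw [← permExp_sum]
      simp only [← mul_sum, Equiv.sum_comp _ y, permExp_mul_const]
    rw [hR, sum_const, card_univ, Fintype.card_fin, nsmul_eq_mul] at hsum
    rw [card_insert_of_notMem ha, pow_succ]
    simp only [prod_insert ha, mul_comm (y _)]
    have hT' : (0 : ℝ) < T := by exact_mod_cast hT
    refine le_trans ?_ (mul_le_mul_of_nonneg_right ih hmean)
    rw [← mul_div_assoc, le_div_iff₀ hT']
    linarith

/-- The exponential lies below its chord. -/
lemma exp_mul_le_of_mem_Icc {x : ℝ} (h0 : 0 ≤ x) (h1 : x ≤ 1) (l : ℝ) :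
    Real.exp (l * x) ≤ 1 + x * (Real.exp l - 1) := by
  have := convexOn_exp.2 (Set.mem_univ l) (Set.mem_univ 0) h0 (sub_nonneg.2 h1)
    (by ring : x + (1 - x) = 1)
  simp only [smul_eq_mul, mul_zero, add_zero, Real.exp_zero, mul_one] at this
  rw [mul_comm]
  linarith

/-- A Poisson-type bound for the moment generating function of a sum sampled without
replacement. -/
lemma permExp_exp_le (hT : 1 ≤ T) {x : Fin T → ℝ} (h0 : ∀ i, 0 ≤ x i) (h1 : ∀ i, x i ≤ 1)
    (M : Finset (Fin T)) (l : ℝ) :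
    permExp (fun π => Real.exp (l * ∑ k ∈ M, (x (π k) - (∑ i, x i) / T))) ≤
      Real.exp (#M * ((∑ i, x i) / T) * (Real.exp l - 1 - l)) := by
  set μ := (∑ i, x i) / T with hμ
  have hT' : (0 : ℝ) < T := by exact_mod_cast hT
  have e1 : ∀ π : Equiv.Perm (Fin T), Real.exp (l * ∑ k ∈ M, (x (π k) - μ)) =
      Real.exp (-(l * μ * #M)) * ∏ k ∈ M, Real.exp (l * x (π k)) := fun π => by
    rw [← Real.exp_sum, ← Real.exp_add, sum_sub_distrib, ← mul_sum]
    simp only [sum_const, nsmul_eq_mul]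
    ring_nf
  simp only [e1, permExp_mul_left]
  have e2 := permExp_prod_le hT (y := fun i => Real.exp (l * x i)) (fun i => (Real.exp_pos _).le) M
  have e3 : (∑ i, Real.exp (l * x i)) / T ≤ Real.exp (μ * (Real.exp l - 1)) := by
    refine le_trans ?_ (Real.add_one_le_exp _)
    rw [div_le_iff₀ hT']
    refine (sum_le_sum fun i _ => exp_mul_le_of_mem_Icc (h0 i) (h1 i) l).trans ?_
    rw [sum_add_distrib, ← sum_mul]
    simp only [sum_const, card_univ, Fintype.card_fin, nsmul_eq_mul, hμ]
    apply le_of_eq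
    field_simp
    ring
  have e4 := e2.trans (pow_le_pow_left₀ (by positivity) e3 #M)
  refine (mul_le_mul_of_nonneg_left e4 (Real.exp_pos _).le).trans ?_
  rw [← Real.exp_nat_mul, ← Real.exp_add]
  apply le_of_eq
  ring_nf

lemma average_apply {d : ℕ} (x : Fin T → Vec d) (j : Fin d) :
    average x j = (∑ i, x i j) / T := by
  simp [average, div_eq_inv_mul]

lemma average_mem_cube {d : ℕ} (hT : 1 ≤ T) {x : Fin T → Vec d} (hx : ∀ i, x i ∈ cube d) :
    average x ∈ cube d := by
  have hT' : (0 : ℝ) < T := by exact_mod_cast hT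
  constructor
  · intro j
    rw [average_apply]
    exact div_nonneg (sum_nonneg fun i _ => (hx i).1 j) hT'.le
  · intro j
    rw [average_apply, div_le_iff₀ hT']
    refine (sum_le_sum fun i _ => (hx i).2 j).trans (by simp)

/-- This is `l ≤ sinh l`. It lets the upper-tail exponent serve for the lower tail as well. -/
lemma exp_neg_le_of_nonneg {l : ℝ} (hl : 0 ≤ l) :
    Real.exp (-l) - 1 - (-l) ≤ Real.exp l - 1 - l := by
  have h := Real.self_le_sinh_iff.2 hl
  rw [Real.sinh_eq] at h
  linarith

/-- The expected sup-norm deviation of a sum of vectors sampled without replacement. -/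
lemma permExp_norm_sum_le {d : ℕ} (hd : 1 ≤ d) (hT : 1 ≤ T) {x : Fin T → Vec d}
    (hx : ∀ i, x i ∈ cube d) {s : ℝ} (hs : ∀ j, average x j ≤ s) (M : Finset (Fin T))
    {l : ℝ} (hl : 0 < l) :
    permExp (fun π => ‖∑ k ∈ M, (x (π k) - average x)‖) ≤
      (Real.log (2 * d) + #M * s * (Real.exp l - 1 - l)) / l := by
  have hd' : (0 : ℝ) < d := by exact_mod_cast hd
  have : Nonempty (Fin d) := ⟨⟨0, hd⟩⟩
  rw [le_div_iff₀ hl, mul_comm, ← permExp_mul_left]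
  set e := #M * s * (Real.exp l - 1 - l) with he
  set B := Real.log (2 * d) + e with hB
  have hexp : 0 ≤ Real.exp l - 1 - l := by linarith [Real.add_one_le_exp l]
  have hmgf : ∀ (j : Fin d) (c : ℝ), Real.exp c - 1 - c ≤ Real.exp l - 1 - l →
      permExp (fun π => Real.exp (c * ∑ k ∈ M, (x (π k) j - average x j))) ≤ Real.exp e := by
    intro j c hc
    simp only [average_apply]
    refine (permExp_exp_le hT (fun i => (hx i).1 j) (fun i => (hx i).2 j) M c).trans ?_
    apply Real.exp_le_exp.2
    rw [← average_apply]
    have h1 : 0 ≤ average x j := (average_mem_cube hT hx).1 j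
    have h2 := hs j
    rw [he]
    have h3 : (#M : ℝ) * average x j ≤ #M * s := by gcongr
    exact (mul_le_mul_of_nonneg_left hc (by positivity)).trans
      (mul_le_mul_of_nonneg_right h3 hexp)
  -- The maximum over coordinates and signs is bounded by the sum of `2d` exponentials; `B` is
  -- chosen to normalize their total mean to at most `1`.
  have hY : permExp (fun π => Real.exp (l * ‖∑ k ∈ M, (x (π k) - average x)‖ - B)) ≤ 1 := by
    have h1 : ∀ π : Equiv.Perm (Fin T), Real.exp (l * ‖∑ k ∈ M, (x (π k) - average x)‖ - B) ≤
        Real.exp (-B) * ∑ j, (Real.exp (l * ∑ k ∈ M, (x (π k) j - average x j)) +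
          Real.exp (-l * ∑ k ∈ M, (x (π k) j - average x j))) := by
      intro π
      rw [sub_eq_neg_add, Real.exp_add]
      refine mul_le_mul_of_nonneg_left ?_ (Real.exp_pos _).le
      obtain ⟨j, hj⟩ := Finite.exists_max
        (fun j => ‖(∑ k ∈ M, (x (π k) - average x)) j‖)
      have h2 : ‖∑ k ∈ M, (x (π k) - average x)‖ ≤ |∑ k ∈ M, (x (π k) j - average x j)| := by
        have h3 := (pi_norm_le_iff_of_nonneg (norm_nonneg _)).2 hj
        simpa using h3
      refine le_trans ?_ (single_le_sum (f := fun j =>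
        Real.exp (l * ∑ k ∈ M, (x (π k) j - average x j)) +
          Real.exp (-l * ∑ k ∈ M, (x (π k) j - average x j)))
        (fun j _ => by positivity) (mem_univ j))
      have h4 := Real.exp_le_exp.2 (mul_le_mul_of_nonneg_left h2 hl.le)
      refine h4.trans ?_
      rcases abs_cases (∑ k ∈ M, (x (π k) j - average x j)) with h5 | h5
      · rw [h5.1]
        linarith [Real.exp_pos (-l * ∑ k ∈ M, (x (π k) j - average x j))]
      · rw [h5.1, mul_neg, ← neg_mul]
        linarith [Real.exp_pos (l * ∑ k ∈ M, (x (π k) j - average x j))]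
    refine (permExp_mono h1).trans ?_
    rw [permExp_mul_left, permExp_sum]
    have h6 : ∀ j ∈ (univ : Finset (Fin d)),
        permExp (fun π => Real.exp (l * ∑ k ∈ M, (x (π k) j - average x j)) +
          Real.exp (-l * ∑ k ∈ M, (x (π k) j - average x j))) ≤ 2 * Real.exp e := by
      intro j _
      rw [permExp_add, two_mul]
      exact add_le_add (hmgf j l le_rfl) (hmgf j (-l) (exp_neg_le_of_nonneg hl.le))
    refine (mul_le_mul_of_nonneg_left (sum_le_sum h6) (Real.exp_pos _).le).trans ?_
    simp only [sum_const, card_univ, Fintype.card_fin, nsmul_eq_mul]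
    rw [hB, neg_add, Real.exp_add, Real.exp_neg, Real.exp_log (by positivity), Real.exp_neg]
    apply le_of_eq
    have := Real.exp_pos e
    field_simp
  -- The tangent line of `exp` replaces Jensen's inequality.
  have h7 : ∀ π : Equiv.Perm (Fin T), l * ‖∑ k ∈ M, (x (π k) - average x)‖ ≤
      Real.exp (l * ‖∑ k ∈ M, (x (π k) - average x)‖ - B) + (B - 1) := fun π => by
    linarith [Real.add_one_le_exp (l * ‖∑ k ∈ M, (x (π k) - average x)‖ - B)]
  refine (permExp_mono h7).trans ?_
  rw [permExp_add, permExp_const]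
  linarith

/-- A first-moment bound that replaces the maximum over coordinates by their sum. It serves very
short suffixes, where `#M * d * s ≤ 1` and exponential moments lose. -/
lemma permExp_norm_sum_le_mul {d : ℕ} (hT : 1 ≤ T) {x : Fin T → Vec d}
    (hx : ∀ i, x i ∈ cube d) {s : ℝ} (hs : ∀ j, average x j ≤ s) (M : Finset (Fin T)) :
    permExp (fun π => ‖∑ k ∈ M, (x (π k) - average x)‖) ≤ 2 * d * s * #M := by
  have h0 : ∀ j, 0 ≤ average x j := (average_mem_cube hT hx).1
  have h1 : ∀ π : Equiv.Perm (Fin T), ‖∑ k ∈ M, (x (π k) - average x)‖ ≤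
      ∑ k ∈ M, ∑ j, (x (π k) j + average x j) := by
    intro π
    refine (norm_sum_le _ _).trans (sum_le_sum fun k _ => ?_)
    rw [pi_norm_le_iff_of_nonneg (sum_nonneg fun j _ => add_nonneg ((hx _).1 j) (h0 j))]
    intro j
    refine le_trans ?_ (single_le_sum (f := fun j => x (π k) j + average x j)
      (fun j _ => add_nonneg ((hx _).1 j) (h0 j)) (mem_univ j))
    have h2 : 0 ≤ x (π k) j := (hx _).1 j
    have h3 := h0 j
    rw [Pi.sub_apply, Real.norm_eq_abs, abs_le]
    constructor <;> linarith
  refine (permExp_mono h1).trans ?_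
  simp only [permExp_sum, permExp_add, permExp_const]
  have h5 : ∀ k j, permExp (fun π : Equiv.Perm (Fin T) => x (π k) j) = average x j := fun k j => by
    rw [average_apply]
    exact permExp_apply hT (fun i => x i j) k
  simp only [h5]
  have h4 : ∀ j ∈ (univ : Finset (Fin d)), average x j + average x j ≤ 2 * s := fun j _ => by
    linarith [hs j]
  refine (sum_le_sum fun k _ => sum_le_sum h4).trans (le_of_eq ?_)
  simp only [sum_const, card_univ, Fintype.card_fin, nsmul_eq_mul]
  ring

lemma norm_sum_sub_average_le {d : ℕ} (hT : 1 ≤ T) {x : Fin T → Vec d}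
    (hx : ∀ i, x i ∈ cube d) (M : Finset (Fin T)) (π : Equiv.Perm (Fin T)) :
    ‖∑ k ∈ M, (x (π k) - average x)‖ ≤ #M := by
  refine (norm_sum_le _ _).trans ((sum_le_sum fun k _ => ?_).trans_eq
    (by simp : ∑ k ∈ M, (1 : ℝ) = _))
  rw [pi_norm_le_iff_of_nonneg zero_le_one]
  exact fun j => abs_sub_le_one_of_mem_cube (hx _) (average_mem_cube hT hx) j

/-- Distinct entries of a random permutation of numbers with sum zero are negatively
correlated. -/
lemma permExp_mul_nonpos {z : Fin T → ℝ} (hz : ∑ i, z i = 0) {k l : Fin T} (hkl : k ≠ l) :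
    permExp (fun π => z (π k) * z (π l)) ≤ 0 := by
  classical
  -- Summing over all second positions gives zero. The diagonal term is nonnegative and the others
  -- are equal to each other, so these cannot be positive.
  have h1 : ∑ l, permExp (fun π : Equiv.Perm (Fin T) => z (π k) * z (π l)) = 0 := by
    rw [← permExp_sum]
    simp only [← mul_sum, Equiv.sum_comp _ z, hz, mul_zero, permExp_const]
  have h2 : ∀ m ∈ univ.erase k, permExp (fun π : Equiv.Perm (Fin T) => z (π k) * z (π m)) =
      permExp (fun π => z (π k) * z (π l)) := by
    intro m hm
    rw [← permExp_comp_mul (Equiv.swap m l)]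
    simp only [Equiv.Perm.mul_apply, Equiv.swap_apply_left,
      Equiv.swap_apply_of_ne_of_ne (ne_of_mem_erase hm).symm hkl]
  rw [← add_sum_erase _ _ (mem_univ k), sum_congr rfl h2, sum_const, nsmul_eq_mul] at h1
  have h3 : 0 ≤ permExp (fun π : Equiv.Perm (Fin T) => z (π k) * z (π k)) :=
    permExp_nonneg fun π => mul_self_nonneg _
  have h4 : 0 < #(univ.erase k) := card_pos.2 ⟨l, by simp [hkl.symm]⟩
  have h5 : (0 : ℝ) < #(univ.erase k) := by exact_mod_cast h4
  by_contra h6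
  push Not at h6
  have := mul_pos h5 h6
  linarith

/-- Off-diagonal covariances are nonpositive, and each variance is at most the mean because `x ^ 2 ≤
x` on `[0,1]`. -/
lemma permExp_sq_sum_le (hT : 1 ≤ T) {x : Fin T → ℝ} (h0 : ∀ i, 0 ≤ x i) (h1 : ∀ i, x i ≤ 1)
    (M : Finset (Fin T)) :
    permExp (fun π => (∑ k ∈ M, (x (π k) - (∑ i, x i) / T)) ^ 2) ≤
      #M * ((∑ i, x i) / T) := by
  classical
  set μ := (∑ i, x i) / T with hμ
  have hT' : (T : ℝ) ≠ 0 := by positivity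
  have hz : ∑ i, (x i - μ) = 0 := by
    rw [sum_sub_distrib]
    simp only [sum_const, card_univ, Fintype.card_fin, nsmul_eq_mul, hμ]
    field_simp
    ring
  have hdiag : ∀ k, permExp (fun π : Equiv.Perm (Fin T) => (x (π k) - μ) * (x (π k) - μ)) ≤ μ := by
    intro k
    have h2 : ∀ π : Equiv.Perm (Fin T), (x (π k) - μ) * (x (π k) - μ) ≤
        (1 - 2 * μ) * x (π k) + μ ^ 2 := fun π => by
      nlinarith [h0 (π k), h1 (π k)]
    refine (permExp_mono h2).trans ?_
    rw [permExp_add, permExp_const, permExp_mul_left, permExp_apply hT x, ← hμ]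
    nlinarith [sq_nonneg μ]
  simp only [sq, sum_mul_sum]
  simp only [permExp_sum]
  have hrow : ∀ k ∈ M, ∑ l ∈ M,
      permExp (fun π : Equiv.Perm (Fin T) => (x (π k) - μ) * (x (π l) - μ)) ≤ μ := by
    intro k hk
    rw [← add_sum_erase _ _ hk]
    have := sum_nonpos fun l (hl : l ∈ M.erase k) =>
      permExp_mul_nonpos (z := fun i => x i - μ) hz (ne_of_mem_erase hl).symm
    linarith [hdiag k]
  refine (sum_le_sum hrow).trans (by simp)

lemma permExp_le_sqrt (F : Equiv.Perm (Fin T) → ℝ) {c : ℝ}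
    (h : permExp (fun π => F π ^ 2) ≤ c) : permExp F ≤ Real.sqrt c := by
  refine Real.le_sqrt_of_sq_le (le_trans ?_ h)
  have h1 := sq_sum_le_card_mul_sum_sq (s := (univ : Finset (Equiv.Perm (Fin T)))) (f := F)
  have h2 : (0 : ℝ) < T.factorial := by positivity
  simp only [permExp, div_pow]
  rw [card_univ, Fintype.card_perm, Fintype.card_fin] at h1
  rw [div_le_div_iff₀ (by positivity) h2]
  nlinarith

lemma euclideanNorm_sq {d : ℕ} (x : Vec d) : euclideanNorm d x ^ 2 = ∑ j, x j ^ 2 := by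
  have : euclideanNorm d x = ‖WithLp.toLp 2 x‖ := rfl
  rw [this, EuclideanSpace.real_norm_sq_eq]

/-- Variances add over coordinates, so no union bound is needed and no additive term arises. -/
lemma permExp_euclideanNorm_sum_le {d : ℕ} (hT : 1 ≤ T) {x : Fin T → Vec d}
    (hx : ∀ i, x i ∈ cube d) {s : ℝ} (hs : ∀ j, average x j ≤ s) (M : Finset (Fin T)) :
    permExp (fun π => euclideanNorm d (∑ k ∈ M, (x (π k) - average x))) ≤
      Real.sqrt (d * s * #M) := by
  apply permExp_le_sqrt
  simp only [euclideanNorm_sq, permExp_sum, Finset.sum_apply, Pi.sub_apply]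
  have h : ∀ j ∈ (univ : Finset (Fin d)),
      permExp (fun π : Equiv.Perm (Fin T) => (∑ k ∈ M, (x (π k) j - average x j)) ^ 2) ≤
        #M * s := by
    intro j _
    simp only [average_apply]
    refine (permExp_sq_sum_le hT (fun i => (hx i).1 j) (fun i => (hx i).2 j) M).trans ?_
    rw [← average_apply]
    exact mul_le_mul_of_nonneg_left (hs j) (by positivity)
  refine (sum_le_sum h).trans (le_of_eq ?_)
  simp only [sum_const, card_univ, Fintype.card_fin, nsmul_eq_mul]
  ring

end permExp

/-! ### Summing the deviations -/

lemma sum_inv_sqrt_le (T : ℕ) :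
    ∑ n ∈ range T, 1 / Real.sqrt ((n + 1 : ℕ) : ℝ) ≤ 2 * Real.sqrt T := by
  induction T with
  | zero => simp
  | succ n ih =>
    rw [sum_range_succ]
    have h1 : 0 < Real.sqrt ((n + 1 : ℕ) : ℝ) := Real.sqrt_pos.2 (by positivity)
    have h2 : 1 / Real.sqrt ((n + 1 : ℕ) : ℝ) ≤
        2 * (Real.sqrt ((n + 1 : ℕ) : ℝ) - Real.sqrt n) := by
      rw [div_le_iff₀ h1]
      have h3 := Real.sq_sqrt (by positivity : (0 : ℝ) ≤ ((n + 1 : ℕ) : ℝ))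
      have h4 := Real.sq_sqrt (by positivity : (0 : ℝ) ≤ (n : ℝ))
      push_cast at *
      nlinarith [sq_nonneg (Real.sqrt ((n : ℝ) + 1) - Real.sqrt n)]
    linarith

lemma sum_ite_mul_le_one (a : ℝ) (T : ℕ) :
    ∑ n ∈ range T, (if ((n + 1 : ℕ) : ℝ) * a ≤ 1 then a else 0) ≤ 1 := by
  -- The additional bound `T * a` closes the induction: whenever the term with index `n` is counted,
  -- the sum up to it is at most `(n + 1) * a ≤ 1`.
  suffices h : ∑ n ∈ range T, (if ((n + 1 : ℕ) : ℝ) * a ≤ 1 then a else 0) ≤ T * a ∧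
      ∑ n ∈ range T, (if ((n + 1 : ℕ) : ℝ) * a ≤ 1 then a else 0) ≤ 1 from h.2
  induction T with
  | zero => simp
  | succ n ih =>
    rw [sum_range_succ]
    obtain ⟨h1, h2⟩ := ih
    push_cast at *
    split_ifs with h
    · constructor <;> linarith
    · constructor <;> linarith

/-- Terms `1 / (m log (1 + c / m))` are controlled by the increments of a double logarithm. -/
lemma one_div_mul_log_le {c m : ℝ} (hm : 1 ≤ m) (hc : m ≤ c) :
    1 / (m * Real.log (1 + c / m)) ≤
      4 * (Real.log (Real.log (1 + c / m)) - Real.log (Real.log (1 + c / (m + 1)))) := by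
  have hm0 : 0 < m := by linarith
  have hc0 : 0 < c := by linarith
  set A := Real.log (1 + c / m) with hA
  set B := Real.log (1 + c / (m + 1)) with hB
  have hA0 : 0 < A := Real.log_pos (by linarith [div_pos hc0 hm0])
  have hB0 : 0 < B := Real.log_pos (by linarith [div_pos hc0 (by linarith : 0 < m + 1)])
  -- From `log y ≥ 1 - 1/y`; the constant `4` comes from `m + 1 ≤ 2m` and `m + c ≤ 2c`. The same
  -- inequality is then applied to the outer logarithm.
  have h1 : 1 / (4 * m) ≤ A - B := by
    rw [hA, hB, ← Real.log_div (by positivity) (by positivity)]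
    have h2 := Real.one_sub_inv_le_log_of_pos
      (show 0 < (1 + c / m) / (1 + c / (m + 1)) by positivity)
    refine le_trans ?_ h2
    have h3 : 1 - ((1 + c / m) / (1 + c / (m + 1)))⁻¹ = c / ((m + 1) * (m + c)) := by
      field_simp
      ring
    rw [h3, div_le_div_iff₀ (by positivity) (by positivity)]
    nlinarith [mul_nonneg hm0.le hc0.le]
  have h4 : 1 - B / A ≤ Real.log A - Real.log B := by
    rw [← Real.log_div hA0.ne' hB0.ne']
    have := Real.one_sub_inv_le_log_of_pos (div_pos hA0 hB0)
    rwa [inv_div] at this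
  have h5 : 1 - B / A = (A - B) / A := by field_simp
  rw [h5] at h4
  have h6 : 1 / (4 * m) / A ≤ (A - B) / A := div_le_div_of_nonneg_right h1 hA0.le
  have h7 : 1 / (4 * m) / A = 1 / (m * A) / 4 := by field_simp
  linarith

/-- The double logarithm of `1 + x`, where `x` is clipped to `[1/2, a]`. -/
def clippedLogLog (a x : ℝ) : ℝ := Real.log (Real.log (1 + max (1 / 2) (min x a)))

lemma clippedLogLog_mono (a : ℝ) {x y : ℝ} (h : x ≤ y) :
    clippedLogLog a x ≤ clippedLogLog a y := by
  have h1 : (1 : ℝ) / 2 ≤ max (1 / 2) (min x a) := le_max_left _ _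
  have h2 : max (1 / 2) (min x a) ≤ max (1 / 2) (min y a) := by gcongr
  have h3 : 0 < Real.log (1 + max (1 / 2) (min x a)) := Real.log_pos (by linarith)
  exact Real.log_le_log h3 (Real.log_le_log (by linarith) (by linarith))

lemma clippedLogLog_le {d : ℕ} (hd : 2 ≤ d) (x : ℝ) :
    clippedLogLog (d * Real.log (2 * d)) x ≤ Real.log (4 * Real.log d) := by
  have hd' : (2 : ℝ) ≤ d := by exact_mod_cast hd
  have h0 : Real.log (2 * d) ≤ 2 * d := by
    have := Real.log_le_sub_one_of_pos (by positivity : (0 : ℝ) < 2 * d)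
    linarith
  have h1 : (1 : ℝ) / 2 ≤ max (1 / 2) (min x (d * Real.log (2 * d))) := le_max_left _ _
  have h2 : max (1 / 2) (min x (d * Real.log (2 * d))) ≤ 2 * (d : ℝ) ^ 2 := by
    refine max_le (by nlinarith) ((min_le_right _ _).trans ?_)
    nlinarith
  -- `1 + 2 d ^ 2 ≤ d ^ 4` for `d ≥ 2`, so the inner logarithm is at most `4 log d`.
  have h3 : 1 + max (1 / 2) (min x (d * Real.log (2 * d))) ≤ (d : ℝ) ^ 4 := by
    have h5 : (4 : ℝ) ≤ (d : ℝ) ^ 2 := by nlinarith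
    have h6 : (d : ℝ) ^ 4 = (d : ℝ) ^ 2 * (d : ℝ) ^ 2 := by ring
    nlinarith
  have h4 : 0 < Real.log (1 + max (1 / 2) (min x (d * Real.log (2 * d)))) :=
    Real.log_pos (by linarith)
  refine Real.log_le_log h4 ((Real.log_le_log (by linarith) h3).trans_eq ?_)
  rw [Real.log_pow]
  norm_num

lemma neg_two_le_clippedLogLog (a x : ℝ) : -2 ≤ clippedLogLog a x := by
  have h1 : (1 : ℝ) / 2 ≤ max (1 / 2) (min x a) := le_max_left _ _
  have h2 : (1 : ℝ) / 3 ≤ Real.log (1 + max (1 / 2) (min x a)) := by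
    have h3 := Real.one_sub_inv_le_log_of_pos (by norm_num : (0 : ℝ) < 3 / 2)
    have h4 : Real.log (3 / 2) ≤ Real.log (1 + max (1 / 2) (min x a)) :=
      Real.log_le_log (by norm_num) (by linarith)
    norm_num at h3
    linarith
  rw [clippedLogLog, Real.le_log_iff_exp_le (by linarith)]
  refine le_trans ?_ h2
  rw [Real.exp_neg, inv_le_comm₀ (Real.exp_pos _) (by norm_num)]
  have := Real.add_one_le_exp (2 : ℝ)
  norm_num
  linarith

lemma one_le_log_two_mul {d : ℕ} (hd : 2 ≤ d) : 1 ≤ Real.log (2 * d) := by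
  have hd' : (2 : ℝ) ≤ d := by exact_mod_cast hd
  rw [Real.le_log_iff_exp_le (by positivity)]
  have := Real.exp_one_lt_d9
  linarith

lemma log_two_mul_le {d : ℕ} (hd : 2 ≤ d) : Real.log (2 * d) ≤ 2 * Real.log d := by
  have hd' : (2 : ℝ) ≤ d := by exact_mod_cast hd
  rw [Real.log_mul (by norm_num) (by positivity)]
  linarith [Real.log_le_log (by norm_num) hd']

lemma half_le_log {d : ℕ} (hd : 2 ≤ d) : 1 / 2 ≤ Real.log d := by
  linarith [one_le_log_two_mul hd, log_two_mul_le hd]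

/-- Three regimes of the suffix length `m`, with `l = log (2d)`. For `m s ≥ l` deviations are
sub-Gaussian, and `∑ 1/√m` yields the square root. For `1/d < m s < l` they are Poisson-like, and
the terms are increments of `log log (1 + l/(s m))`, whose argument stays between constants and a
power of `d`; this yields `log d * log (1 + log d)`. For `m s ≤ 1/d` each term is at most `2 d s`,
and there are at most `1/(d s)` of them. -/
lemma sum_le_of_bennett {d : ℕ} (hd : 2 ≤ d) {s : ℝ} (hs0 : 0 ≤ s) (T : ℕ)
    {e : ℕ → ℝ}
    (h1 : ∀ m : ℕ, 1 ≤ m → Real.log (2 * d) ≤ m * s →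
      e m ≤ 2 * Real.sqrt (Real.log (2 * d) * s) * (1 / Real.sqrt m))
    (h2 : ∀ m : ℕ, 1 ≤ m → 0 < s → m * s < Real.log (2 * d) →
      e m ≤ 2 * Real.log (2 * d) * (1 / (m * Real.log (1 + Real.log (2 * d) / s / m))))
    (h3 : ∀ m : ℕ, 1 ≤ m → m * s < Real.log (2 * d) → e m ≤ 2 * (d * s)) :
    ∑ n ∈ range T, e (n + 1) ≤
      300 * (Real.sqrt (s * T * Real.log d) + Real.log d * Real.log (1 + Real.log d)) := by
  have hd' : (2 : ℝ) ≤ d := by exact_mod_cast hd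
  set l := Real.log (2 * d) with hl
  have hl1 : 1 ≤ l := one_le_log_two_mul hd
  have hl2 : l ≤ 2 * Real.log d := log_two_mul_le hd
  -- If `s = 0`, then `c = 0` by the convention for division; only the third regime then occurs and
  -- all increments of `H` vanish.
  set c := l / s with hc
  -- Clipping makes the increments nonnegative for every `m`, so they can be telescoped over the
  -- whole range; in the middle regime the clipping is inactive.
  set H := clippedLogLog (d * l) with hH
  have hHm : ∀ n : ℕ, 0 ≤ H (c / (n + 1 : ℕ)) - H (c / (n + 1 + 1 : ℕ)) := by
    intro n
    rw [sub_nonneg]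
    refine clippedLogLog_mono _ ?_
    have : 0 ≤ c := by positivity
    push_cast
    gcongr
    linarith
  have hpt : ∀ n ∈ range T, e (n + 1) ≤
      2 * Real.sqrt (l * s) * (1 / Real.sqrt (n + 1 : ℕ)) +
      2 * (if ((n + 1 : ℕ) : ℝ) * (d * s) ≤ 1 then d * s else 0) +
      8 * l * (H (c / (n + 1 : ℕ)) - H (c / (n + 1 + 1 : ℕ))) := by
    intro n _
    have t1 : 0 ≤ 2 * Real.sqrt (l * s) * (1 / Real.sqrt (n + 1 : ℕ)) := by positivity
    have t2 : 0 ≤ 2 * (if ((n + 1 : ℕ) : ℝ) * (d * s) ≤ 1 then d * s else 0) := by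
      split_ifs <;> positivity
    have t3 : 0 ≤ 8 * l * (H (c / (n + 1 : ℕ)) - H (c / (n + 1 + 1 : ℕ))) :=
      mul_nonneg (by positivity) (hHm n)
    by_cases c1 : l ≤ (n + 1 : ℕ) * s
    · linarith [h1 (n + 1) (by omega) c1]
    · push Not at c1
      by_cases c2 : ((n + 1 : ℕ) : ℝ) * (d * s) ≤ 1
      · rw [if_pos c2] at t2 ⊢
        linarith [h3 (n + 1) (by omega) c1]
      · push Not at c2
        have hs : 0 < s := by
          refine lt_of_le_of_ne hs0 ?_
          rintro rfl
          norm_num at c2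
        have hm1 : (1 : ℝ) ≤ (n + 1 : ℕ) := by push_cast; linarith [(Nat.cast_nonneg n : (0:ℝ) ≤ n)]
        have hmc : ((n + 1 : ℕ) : ℝ) ≤ c := by rw [hc, le_div_iff₀ hs]; exact c1.le
        have hcm : c / (n + 1 : ℕ) ≤ d * l := by
          rw [hc, div_div, div_le_iff₀ (by positivity)]
          nlinarith
        have e1 : H (c / (n + 1 : ℕ)) = Real.log (Real.log (1 + c / (n + 1 : ℕ))) := by
          rw [hH, clippedLogLog, min_eq_left hcm, max_eq_right]
          rw [le_div_iff₀ (by positivity)]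
          linarith
        have e2 : H (c / (n + 1 + 1 : ℕ)) =
            Real.log (Real.log (1 + c / ((n + 1 : ℕ) + 1))) := by
          have h5 : c / (n + 1 + 1 : ℕ) ≤ c / (n + 1 : ℕ) := by
            have : 0 ≤ c := by positivity
            push_cast
            gcongr
            linarith
          rw [hH, clippedLogLog, min_eq_left (h5.trans hcm), max_eq_right]
          · push_cast; rfl
          · rw [le_div_iff₀ (by positivity)]
            push_cast at *
            linarith
        have h6 := one_div_mul_log_le hm1 hmc
        have h7 := h2 (n + 1) (by omega) hs c1
        have h8 := mul_le_mul_of_nonneg_left h6 (by positivity : 0 ≤ 2 * l)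
        rw [e1, e2]
        rw [e1, e2] at t3
        linarith
  have htel : ∑ n ∈ range T, (H (c / (n + 1 : ℕ)) - H (c / (n + 1 + 1 : ℕ))) ≤
      Real.log (4 * Real.log d) + 2 := by
    rw [sum_range_sub' (fun n : ℕ => H (c / (n + 1 : ℕ)))]
    have := clippedLogLog_le hd (c / (0 + 1 : ℕ))
    have := neg_two_le_clippedLogLog (d * l) (c / (T + 1 : ℕ))
    linarith
  refine (sum_le_sum hpt).trans ?_
  rw [sum_add_distrib, sum_add_distrib, ← mul_sum, ← mul_sum, ← mul_sum]
  have s1 := mul_le_mul_of_nonneg_left (sum_inv_sqrt_le T)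
    (by positivity : 0 ≤ 2 * Real.sqrt (l * s))
  have s2 := sum_ite_mul_le_one (d * s) T
  have s3 := mul_le_mul_of_nonneg_left htel (by positivity : 0 ≤ 8 * l)
  have ld := half_le_log hd
  set D := Real.log d with hD
  set u := Real.log (1 + D) with hu
  have hu3 : 1 / 3 ≤ u := by
    have h3 := Real.one_sub_inv_le_log_of_pos (by norm_num : (0 : ℝ) < 3 / 2)
    have h4 : Real.log (3 / 2) ≤ u := Real.log_le_log (by norm_num) (by linarith)
    norm_num at h3
    linarith
  have hlog : Real.log (4 * D) ≤ 2 + u := by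
    rw [Real.log_mul (by norm_num) (by positivity)]
    have h5 : Real.log 4 ≤ 2 := by
      rw [Real.log_le_iff_le_exp (by norm_num)]
      have h6 := Real.quadratic_le_exp_of_nonneg (by norm_num : (0 : ℝ) ≤ 2)
      linarith
    have h7 : Real.log D ≤ u := Real.log_le_log (by positivity) (by linarith)
    linarith
  have r1 : 2 * Real.sqrt (l * s) * (2 * Real.sqrt T) ≤ 8 * Real.sqrt (s * T * D) := by
    have h8 : Real.sqrt (l * s) * Real.sqrt T ≤ 2 * Real.sqrt (s * T * D) := by
      rw [← Real.sqrt_mul (by positivity)]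
      apply Real.sqrt_le_iff.2 ⟨by positivity, ?_⟩
      rw [mul_pow, Real.sq_sqrt (by positivity)]
      have : 0 ≤ s * T := by positivity
      nlinarith
    linarith
  have r2 : 8 * l * (Real.log (4 * D) + 2) ≤ 16 * D * (13 * u) := by
    have h9 : 0 ≤ Real.log (4 * D) + 2 := by
      have : 0 ≤ Real.log (4 * D) := Real.log_nonneg (by linarith)
      linarith
    have h10 : 8 * l ≤ 16 * D := by linarith
    exact mul_le_mul h10 (by linarith) h9 (by positivity)
  -- The constant left by the shortest suffixes is absorbed, since `D ≥ 1/2` and `u ≥ 1/3`.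
  have r3 : 2 ≤ 12 * (D * u) := by nlinarith
  have r4 : 0 ≤ D * u := by positivity
  have r5 : 0 ≤ Real.sqrt (s * T * D) := Real.sqrt_nonneg _
  linarith

/-! ### Mean deviation of the unseen vectors, summed over the steps. -/

section deviation

variable {d T : ℕ} {x : Fin T → Vec d}

lemma permExp_norm_sum_le_sqrt (hd : 2 ≤ d) (hT : 1 ≤ T) (hx : ∀ i, x i ∈ cube d) {s : ℝ}
    (hs : ∀ j, average x j ≤ s) (M : Finset (Fin T)) (hM : Real.log (2 * d) ≤ #M * s) :
    permExp (fun π => ‖∑ k ∈ M, (x (π k) - average x)‖) ≤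
      2 * Real.sqrt (Real.log (2 * d) * (#M * s)) := by
  set l := Real.log (2 * d) with hl
  have hl1 : 1 ≤ l := one_le_log_two_mul hd
  set q := #M * s with hq
  have hq0 : 0 < q := by linarith
  -- The value of the exponential parameter that balances `l` and `q * r ^ 2`; `r ≤ 1` makes the
  -- quadratic bound on `exp r - 1 - r` available.
  set r := Real.sqrt (l / q) with hr
  have hr0 : 0 < r := Real.sqrt_pos.2 (by positivity)
  have hr1 : r ≤ 1 := Real.sqrt_le_one.2 ((div_le_one hq0).2 hM)
  have hr2 : r ^ 2 = l / q := Real.sq_sqrt (by positivity)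
  refine (permExp_norm_sum_le (by omega) hT hx hs M hr0).trans ?_
  rw [← hl, ← hq, div_le_iff₀ hr0]
  have h1 := Real.abs_exp_sub_one_sub_id_le (abs_le.2 ⟨by linarith, hr1⟩)
  have h2 : q * (Real.exp r - 1 - r) ≤ l := by
    have h3 := mul_le_mul_of_nonneg_left ((le_abs_self _).trans h1) hq0.le
    rw [hr2] at h3
    have : q * (l / q) = l := by field_simp
    linarith
  have h4 : Real.sqrt (l * q) * r = l := by
    rw [hr, ← Real.sqrt_mul (by positivity)]
    have : l * q * (l / q) = l ^ 2 := by field_simp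
    rw [this, Real.sqrt_sq (by linarith)]
  linarith

/-- The case `s = 1`, extended to sets smaller than `log (2d)`, where the trivial bound `#M` is
already good enough. -/
lemma permExp_norm_sum_le_sqrt_card (hd : 2 ≤ d) (hT : 1 ≤ T) (hx : ∀ i, x i ∈ cube d)
    (M : Finset (Fin T)) :
    permExp (fun π => ‖∑ k ∈ M, (x (π k) - average x)‖) ≤
      2 * Real.sqrt (Real.log (2 * d) * #M) := by
  by_cases h : Real.log (2 * d) ≤ #M
  · have h1 : ∀ j, average x j ≤ (1 : ℝ) := (average_mem_cube hT hx).2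
    have := permExp_norm_sum_le_sqrt (s := (1 : ℝ)) hd hT hx h1 M (by rwa [mul_one])
    rwa [mul_one] at this
  · push Not at h
    refine (permExp_mono (norm_sum_sub_average_le hT hx M)).trans ?_
    rw [permExp_const]
    have h1 : (#M : ℝ) ≤ Real.sqrt (Real.log (2 * d) * #M) := by
      apply Real.le_sqrt_of_sq_le
      rw [sq]
      exact mul_le_mul_of_nonneg_right h.le (by positivity)
    linarith [Real.sqrt_nonneg (Real.log (2 * d) * #M)]

lemma permExp_norm_sum_le_log (hd : 2 ≤ d) (hT : 1 ≤ T) (hx : ∀ i, x i ∈ cube d) {s : ℝ}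
    (hs : ∀ j, average x j ≤ s) (M : Finset (Fin T)) (hM : 0 < #M * s) :
    permExp (fun π => ‖∑ k ∈ M, (x (π k) - average x)‖) ≤
      2 * Real.log (2 * d) / Real.log (1 + Real.log (2 * d) / (#M * s)) := by
  have hl1 : 1 ≤ Real.log (2 * d) := one_le_log_two_mul hd
  set l := Real.log (2 * d) with hl
  set q := #M * s with hq
  have hlq : 0 < l / q := by positivity
  have hr0 : 0 < Real.log (1 + l / q) := Real.log_pos (by linarith)
  -- With the parameter `log (1 + l / q)` the term `q * (exp r - 1)` is exactly `l`.
  refine (permExp_norm_sum_le (by omega) hT hx hs M hr0).trans ?_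
  rw [← hl, ← hq]
  refine div_le_div_of_nonneg_right ?_ hr0.le
  rw [Real.exp_log (by linarith)]
  have h1 : q * (1 + l / q - 1 - Real.log (1 + l / q)) = l - q * Real.log (1 + l / q) := by
    field_simp
    ring
  rw [h1]
  have := mul_pos hM hr0
  linarith

/-- The mean norm of the deviation of the average of the vectors in the positions of `M`. -/
def meanDeviation (N : Seminorm ℝ (Vec d)) (x : Fin T → Vec d) (M : Finset (Fin T)) : ℝ :=
  permExp (fun π => N ((#M : ℝ)⁻¹ • ∑ k ∈ M, (x (π k) - average x)))

lemma meanDeviation_eq (N : Seminorm ℝ (Vec d)) (x : Fin T → Vec d) (M : Finset (Fin T)) :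
    meanDeviation N x M =
      (#M : ℝ)⁻¹ * permExp (fun π => N (∑ k ∈ M, (x (π k) - average x))) := by
  rw [← permExp_mul_left]
  simp only [meanDeviation, map_smul_eq_mul, norm_inv, RCLike.norm_natCast]

/-- The suffix starting at `t` has `T - t` elements, so the suffix sizes run through `1, …, T`. -/
lemma sum_Ici_card (e : ℕ → ℝ) : ∑ t : Fin T, e #(Ici t) = ∑ n ∈ range T, e (n + 1) := by
  simp only [Fin.card_Ici]
  rw [Fin.sum_univ_eq_sum_range (fun t => e (T - t)), ← sum_range_reflect]
  refine sum_congr rfl fun n hn => ?_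
  rw [mem_range] at hn
  congr 1
  omega

lemma meanDeviation_le_mul_supNorm {N : Seminorm ℝ (Vec d)} (hN : ∀ x, N x ≤ N 1 * supNorm d x)
    (x : Fin T → Vec d) (M : Finset (Fin T)) :
    meanDeviation N x M ≤ N 1 * meanDeviation (supNorm d) x M := by
  rw [meanDeviation, meanDeviation, ← permExp_mul_left]
  exact permExp_mono fun π => hN _

lemma sum_meanDeviation_supNorm_le_sqrt (hd : 2 ≤ d) (hT : 1 ≤ T) (hx : ∀ i, x i ∈ cube d) :
    ∑ t : Fin T, meanDeviation (supNorm d) x (Ici t) ≤ 300 * Real.sqrt (T * Real.log d) := by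
  set l := Real.log (2 * d) with hl
  have hl1 : 1 ≤ l := one_le_log_two_mul hd
  have hl2 : l ≤ 2 * Real.log d := log_two_mul_le hd
  have h1 : ∀ t ∈ (univ : Finset (Fin T)), meanDeviation (supNorm d) x (Ici t) ≤
      2 * Real.sqrt l * (1 / Real.sqrt (#(Ici t) : ℕ)) := by
    intro t _
    have hM : (0 : ℝ) < #(Ici t) := by
      exact_mod_cast card_pos.2 ⟨t, mem_Ici.2 le_rfl⟩
    rw [meanDeviation_eq, inv_mul_le_iff₀ hM]
    refine (permExp_norm_sum_le_sqrt_card hd hT hx (Ici t)).trans (le_of_eq ?_)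
    have h2 := Real.sqrt_pos.2 hM
    rw [← hl, Real.sqrt_mul (by linarith)]
    field_simp
    rw [Real.sq_sqrt hM.le]
  refine (sum_le_sum h1).trans ?_
  rw [← mul_sum, sum_Ici_card (fun m => 1 / Real.sqrt m)]
  refine (mul_le_mul_of_nonneg_left (sum_inv_sqrt_le T) (by positivity)).trans ?_
  have h3 : Real.sqrt l * Real.sqrt T ≤ 2 * Real.sqrt (T * Real.log d) := by
    rw [← Real.sqrt_mul (by linarith)]
    apply Real.sqrt_le_iff.2 ⟨by positivity, ?_⟩
    have := half_le_log hd
    rw [mul_pow, Real.sq_sqrt (by positivity)]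
    have : (0 : ℝ) ≤ T := by positivity
    nlinarith
  nlinarith [Real.sqrt_nonneg (T * Real.log d)]

lemma sum_meanDeviation_supNorm_le (hd : 2 ≤ d) (hT : 1 ≤ T) (hx : ∀ i, x i ∈ cube d) {s : ℝ}
    (hs0 : 0 ≤ s) (hs : ∀ j, average x j ≤ s) :
    ∑ t : Fin T, meanDeviation (supNorm d) x (Ici t) ≤
      300 * (Real.sqrt (s * T * Real.log d) + Real.log d * Real.log (1 + Real.log d)) := by
  set l := Real.log (2 * d) with hl
  have hl1 : 1 ≤ l := one_le_log_two_mul hd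
  let b₁ : ℕ → ℝ := fun m => 2 * Real.sqrt (l * s) * (1 / Real.sqrt m)
  let b₂ : ℕ → ℝ := fun m => 2 * l * (1 / (m * Real.log (1 + l / s / m)))
  let b₃ : ℝ := 2 * (d * s)
  let e : ℕ → ℝ := fun m => if l ≤ m * s then b₁ m else if 0 < s then min (b₂ m) b₃ else b₃
  have he : ∀ t ∈ (univ : Finset (Fin T)),
      meanDeviation (supNorm d) x (Ici t) ≤ e #(Ici t) := by
    intro t _
    have hM : (0 : ℝ) < #(Ici t) := by
      exact_mod_cast card_pos.2 ⟨t, mem_Ici.2 le_rfl⟩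
    rw [meanDeviation_eq, inv_mul_le_iff₀ hM]
    have h3 : permExp (fun π => supNorm d (∑ k ∈ Ici t, (x (π k) - average x))) ≤
        #(Ici t) * b₃ := by
      refine (permExp_norm_sum_le_mul hT hx hs (Ici t)).trans (le_of_eq ?_)
      simp only [b₃]
      ring
    simp only [e]
    split_ifs with c1 c2
    · refine (permExp_norm_sum_le_sqrt hd hT hx hs (Ici t) c1).trans (le_of_eq ?_)
      simp only [b₁]
      have h2 := Real.sqrt_pos.2 hM
      rw [← hl, mul_left_comm l, Real.sqrt_mul hM.le]
      field_simp
      rw [Real.sq_sqrt hM.le, mul_comm]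
    · rw [mul_min_of_nonneg _ _ hM.le]
      refine le_min ?_ h3
      refine (permExp_norm_sum_le_log hd hT hx hs (Ici t) (by positivity)).trans (le_of_eq ?_)
      simp only [b₂]
      rw [← hl, div_div, mul_comm s]
      have h4 : 0 < Real.log (1 + l / (#(Ici t) * s)) := by
        apply Real.log_pos
        have : 0 < l / (#(Ici t) * s) := by positivity
        linarith
      field_simp
    · exact h3
  refine (sum_le_sum he).trans ?_
  rw [sum_Ici_card]
  refine sum_le_of_bennett hd hs0 T (fun m _ h => ?_) (fun m _ h h' => ?_) (fun m _ h => ?_)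
  · simp only [e]
    rw [if_pos h]
  · simp only [e]
    rw [if_neg (not_le.2 h'), if_pos h]
    exact min_le_left _ _
  · simp only [e]
    rw [if_neg (not_le.2 h)]
    split_ifs
    · exact min_le_right _ _
    · exact le_rfl

lemma euclideanNorm_one (d : ℕ) : euclideanNorm d 1 = Real.sqrt d := by
  have h := euclideanNorm_sq (1 : Vec d)
  rw [← Real.sqrt_sq (apply_nonneg (euclideanNorm d) 1), h]
  simp

lemma sum_meanDeviation_euclideanNorm_le (hd : 2 ≤ d) (hT : 1 ≤ T) (hx : ∀ i, x i ∈ cube d)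
    {s : ℝ} (hs0 : 0 ≤ s) (hs : ∀ j, average x j ≤ s) :
    ∑ t : Fin T, meanDeviation (euclideanNorm d) x (Ici t) ≤
      300 * (euclideanNorm d 1 * Real.sqrt (s * T * Real.log d)) := by
  have h1 : ∀ t ∈ (univ : Finset (Fin T)), meanDeviation (euclideanNorm d) x (Ici t) ≤
      Real.sqrt (d * s) * (1 / Real.sqrt (#(Ici t) : ℕ)) := by
    intro t _
    have hM : (0 : ℝ) < #(Ici t) := by
      exact_mod_cast card_pos.2 ⟨t, mem_Ici.2 le_rfl⟩
    rw [meanDeviation_eq, inv_mul_le_iff₀ hM]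
    refine (permExp_euclideanNorm_sum_le hT hx hs (Ici t)).trans (le_of_eq ?_)
    have h2 := Real.sqrt_pos.2 hM
    rw [Real.sqrt_mul (by positivity)]
    field_simp
    rw [Real.sq_sqrt hM.le]
  refine (sum_le_sum h1).trans ?_
  rw [← mul_sum, sum_Ici_card (fun m => 1 / Real.sqrt m)]
  refine (mul_le_mul_of_nonneg_left (sum_inv_sqrt_le T) (by positivity)).trans ?_
  rw [euclideanNorm_one, ← Real.sqrt_mul (by positivity)]
  have h3 : Real.sqrt (d * s) * Real.sqrt T ≤ 2 * Real.sqrt (d * (s * T * Real.log d)) := by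
    rw [← Real.sqrt_mul (by positivity)]
    apply Real.sqrt_le_iff.2 ⟨by positivity, ?_⟩
    -- The factor `log d ≥ 1/2` is not produced by the variance bound; it is only inserted to match
    -- the stated form.
    have := half_le_log hd
    rw [mul_pow, Real.sq_sqrt (by positivity)]
    have : (0 : ℝ) ≤ d * (s * T) := by positivity
    nlinarith
  nlinarith [Real.sqrt_nonneg (d * (s * T * Real.log d))]

end deviation

/-! ### From online linear optimization to online convex optimization -/

section learners

variable {d : ℕ}

/-- `G ∈ [-1,1]^d` is a supergradient of `p` at `θ`. -/
def IsUnitSupergradient (p : Vec d → ℝ) (θ G : Vec d) : Prop :=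
  (∀ j, |G j| ≤ 1) ∧ ∀ θ', p θ' ≤ p θ + (θ' - θ) ⬝ᵥ G

/-- `p` has supergradients in `[-1,1]^d` everywhere. -/
def HasUnitSupergradients (p : Vec d → ℝ) : Prop := ∀ θ, ∃ G, IsUnitSupergradient p θ G

open Classical in
/-- A supergradient of `p` at `θ` in `[-1,1]^d`, if there is one. -/
def unitSupergradient (p : Vec d → ℝ) (θ : Vec d) : Vec d :=
  if h : ∃ G, IsUnitSupergradient p θ G then h.choose else 0

lemma HasUnitSupergradients.spec {p : Vec d → ℝ} (hp : HasUnitSupergradients p) (θ : Vec d) :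
    IsUnitSupergradient p θ (unitSupergradient p θ) := by
  rw [unitSupergradient, dif_pos (hp θ)]
  exact (hp θ).choose_spec

/-- The supergradients met by a linear learner that is scaled by `r`, most recent first. -/
def supergradients (r : ℝ) (base : List (Vec d) → Vec d) : List (Vec d → ℝ) → List (Vec d)
  | [] => []
  | p :: ps => unitSupergradient p (r • base (supergradients r base ps)) ::
      supergradients r base ps

/-- The learner that plays a scaled linear learner against supergradients. -/
def linearized (r : ℝ) (base : List (Vec d) → Vec d) : Learner d :=
  fun ps => r • base (supergradients r base ps)

/-- The total payoff of a linear learner. -/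
def linearPayoff (base : List (Vec d) → Vec d) : List (Vec d) → ℝ
  | [] => 0
  | G :: Gs => linearPayoff base Gs + base Gs ⬝ᵥ G

lemma length_supergradients (r : ℝ) (base : List (Vec d) → Vec d) (ps : List (Vec d → ℝ)) :
    (supergradients r base ps).length = ps.length := by
  induction ps with
  | nil => rfl
  | cons p ps ih => simp [supergradients, ih]

lemma abs_le_one_of_mem_supergradients (r : ℝ) (base : List (Vec d) → Vec d)
    {ps : List (Vec d → ℝ)} (hps : ∀ p ∈ ps, HasUnitSupergradients p) :
    ∀ G ∈ supergradients r base ps, ∀ j, |G j| ≤ 1 := by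
  induction ps with
  | nil => simp [supergradients]
  | cons p ps ih =>
    intro G hG
    rw [supergradients, List.mem_cons] at hG
    rcases hG with rfl | hG
    · exact ((hps p (by simp)).spec _).1
    · exact ih (fun q hq => hps q (by simp [hq])) G hG

/-- Each supergradient inequality bounds the loss of one round by its linear version, and the
scaling factor `r` comes out. -/
lemma sum_sub_learnerPayoff_le {r : ℝ} (base : List (Vec d) → Vec d) {ps : List (Vec d → ℝ)}
    (hps : ∀ p ∈ ps, HasUnitSupergradients p) (u : Vec d) :
    (ps.map (fun p => p (r • u))).sum - learnerPayoff (linearized r base) ps ≤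
      r * (u ⬝ᵥ (supergradients r base ps).sum -
        linearPayoff base (supergradients r base ps)) := by
  induction ps with
  | nil => simp [supergradients, learnerPayoff, linearPayoff]
  | cons p ps ih =>
    have h1 := ih (fun q hq => hps q (by simp [hq]))
    have h2 := ((hps p (by simp)).spec (linearized r base ps)).2 (r • u)
    simp only [List.map_cons, List.sum_cons, learnerPayoff, supergradients, linearPayoff,
      dotProduct_add]
    have h3 : (r • u - linearized r base ps) ⬝ᵥ
          unitSupergradient p (linearized r base ps) =
        r * (u ⬝ᵥ unitSupergradient p (linearized r base ps) -
          base (supergradients r base ps) ⬝ᵥ unitSupergradient p (linearized r base ps)) := by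
      rw [linearized, ← smul_sub, smul_dotProduct, sub_dotProduct, smul_eq_mul]
    have h4 : unitSupergradient p (r • base (supergradients r base ps)) =
      unitSupergradient p (linearized r base ps) := rfl
    rw [h4]
    rw [h3] at h2
    linarith

lemma smul_mem_dualBall {N : Seminorm ℝ (Vec d)} (hN : ∀ x, N x = 0 → x = 0) {r : ℝ}
    (hr : 0 ≤ r) {u : Vec d} (hu : u ∈ dualBall N 1) : r • u ∈ dualBall N r := by
  rw [mem_dualBall_iff hN zero_le_one] at hu
  rw [mem_dualBall_iff hN hr]
  intro x
  rw [dotProduct_smul, smul_eq_mul]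
  have := mul_le_mul_of_nonneg_left (hu x) hr
  linarith

lemma exists_eq_smul_of_mem_dualBall {N : Seminorm ℝ (Vec d)} (hN : ∀ x, N x = 0 → x = 0)
    {r : ℝ} (hr : 0 ≤ r) {θ : Vec d} (hθ : θ ∈ dualBall N r) :
    ∃ u ∈ dualBall N 1, θ = r • u := by
  rcases eq_or_lt_of_le hr with rfl | hr0
  · refine ⟨0, zero_mem_dualBall zero_le_one, ?_⟩
    rw [mem_dualBall_iff hN le_rfl] at hθ
    -- The ball of radius `0` is trivial: testing `θ` against itself gives `θ · θ ≤ 0`.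
    have h1 := hθ θ
    rw [zero_mul] at h1
    rw [smul_zero]
    have h2 : 0 ≤ θ ⬝ᵥ θ := sum_nonneg fun j _ => mul_self_nonneg _
    exact dotProduct_self_eq_zero.1 (le_antisymm h1 h2)
  · refine ⟨r⁻¹ • θ, ?_, by rw [smul_smul, mul_inv_cancel₀ hr0.ne', one_smul]⟩
    rw [mem_dualBall_iff hN hr] at hθ
    rw [mem_dualBall_iff hN zero_le_one]
    intro x
    rw [dotProduct_smul, smul_eq_mul, inv_mul_le_iff₀ hr0]
    have := hθ x
    linarith

/-- A linear learner with regret at most `b` on the dual unit ball. -/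
structure IsLinearLearner (N : Seminorm ℝ (Vec d)) (T : ℕ) (b : ℝ)
    (base : List (Vec d) → Vec d) : Prop where
  mem : ∀ Gs, base Gs ∈ dualBall N 1
  regret_le : ∀ Gs : List (Vec d), Gs.length = T → (∀ G ∈ Gs, ∀ j, |G j| ≤ 1) →
    ∀ u ∈ dualBall N 1, u ⬝ᵥ Gs.sum - linearPayoff base Gs ≤ b

lemma IsLinearLearner.ocoRegret_le {N : Seminorm ℝ (Vec d)} (hN : ∀ x, N x = 0 → x = 0) {T : ℕ}
    {b : ℝ} {base : List (Vec d) → Vec d} (h : IsLinearLearner N T b base) {r : ℝ} (hr : 0 ≤ r)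
    {ps : List (Vec d → ℝ)} (hT : ps.length = T) (hps : ∀ p ∈ ps, HasUnitSupergradients p) :
    ocoRegret (dualBall N r) (linearized r base) ps ≤ r * b := by
  rw [ocoRegret, sub_le_iff_le_add]
  refine csSup_le (Set.Nonempty.image _ ⟨0, zero_mem_dualBall hr⟩) ?_
  rintro _ ⟨θ, hθ, rfl⟩
  obtain ⟨u, hu, rfl⟩ := exists_eq_smul_of_mem_dualBall hN hr hθ
  have h1 := sum_sub_learnerPayoff_le (r := r) base hps u
  have h2 := h.regret_le (supergradients r base ps) (by rw [length_supergradients, hT])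
    (abs_le_one_of_mem_supergradients r base hps) u hu
  have h3 := mul_le_mul_of_nonneg_left h2 hr
  simp only
  linarith

/-! ### The payoff functions have supergradients -/

/-- A subgradient of `H` in the cube leaves `v - y`, a difference of two points of the cube. -/
lemma hasUnitSupergradients_of_subgradient {H : Vec d → ℝ}
    (hH : ∀ θ, ∃ y ∈ cube d, ∀ θ', H θ + (θ' - θ) ⬝ᵥ y ≤ H θ') {v : Vec d} (hv : v ∈ cube d) :
    HasUnitSupergradients (fun θ => θ ⬝ᵥ v - H θ) := by
  intro θ
  obtain ⟨y, hy, h⟩ := hH θ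
  refine ⟨v - y, abs_sub_le_one_of_mem_cube hv hy, fun θ' => ?_⟩
  have := h θ'
  simp only [dotProduct_sub, sub_dotProduct] at *
  linarith

lemma continuous_dotProduct_right (θ : Vec d) : Continuous fun y : Vec d => θ ⬝ᵥ y := by
  unfold dotProduct
  fun_prop

/-- A maximizer of `θ · y` is a subgradient of the support function. It is taken in the closure of
`S`, where the maximum is attained and which has the same support function. -/
lemma hasUnitSupergradients_constraintPayoff {S : Set (Vec d)} (hS : S ⊆ cube d)
    (hne : S.Nonempty) {v : Vec d} (hv : v ∈ cube d) :
    HasUnitSupergradients (constraintPayoff S v) := by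
  refine hasUnitSupergradients_of_subgradient (fun θ => ?_) hv
  have hcl : closure S ⊆ cube d := closure_minimal hS isClosed_Icc
  have hcomp : IsCompact (closure S) := isCompact_Icc.of_isClosed_subset isClosed_closure hcl
  obtain ⟨y, hy, hmax⟩ := hcomp.exists_isMaxOn hne.closure
    (continuous_dotProduct_right θ).continuousOn
  refine ⟨y, hcl hy, fun θ' => ?_⟩
  have h1 : supportFn S θ ≤ θ ⬝ᵥ y := by
    refine csSup_le (hne.image _) ?_
    rintro _ ⟨z, hz, rfl⟩
    exact hmax (subset_closure hz)
  have h2 : θ' ⬝ᵥ y ≤ supportFn S θ' :=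
    closure_minimal (fun z hz => dotProduct_le_supportFn hS hz θ')
      (isClosed_le (continuous_dotProduct_right θ') continuous_const) hy
  rw [sub_dotProduct]
  linarith

lemma IsProblem.continuousOn {N : Seminorm ℝ (Vec d)} {f : Vec d → ℝ} {S : Set (Vec d)} {L : ℝ}
    (hp : IsProblem N f S L) : ContinuousOn f (cube d) := by
  have hC : 0 ≤ ∑ j : Fin d, N (Pi.single j 1) := sum_nonneg fun _ _ => apply_nonneg _ _
  refine (LipschitzOnWith.of_dist_le_mul
    (K := (L * ∑ j : Fin d, N (Pi.single j 1)).toNNReal)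
    fun x hx y hy => ?_).continuousOn
  rw [Real.dist_eq, dist_eq_norm, Real.coe_toNNReal _ (mul_nonneg hp.nonneg hC)]
  refine (hp.lipschitz x hx y hy).trans ?_
  have := mul_le_mul_of_nonneg_left (seminorm_le_sum N (x - y)) hp.nonneg
  linarith

/-- A point of the cube that attains the conjugate at `φ` is a subgradient of the conjugate there.
-/
lemma IsProblem.hasUnitSupergradients_objectivePayoff {N : Seminorm ℝ (Vec d)} {f : Vec d → ℝ}
    {S : Set (Vec d)} {L : ℝ} (hp : IsProblem N f S L) {v : Vec d} (hv : v ∈ cube d) :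
    HasUnitSupergradients (objectivePayoff f v) := by
  refine hasUnitSupergradients_of_subgradient (fun φ => ?_) hv
  obtain ⟨y, hy, hmax⟩ := (isCompact_Icc (a := (0 : Vec d)) (b := 1)).exists_isMaxOn
    ⟨v, hv⟩ ((continuous_dotProduct_right φ).continuousOn.add hp.continuousOn)
  refine ⟨y, hy, fun φ' => ?_⟩
  have h1 : conjugate (fun y => -f y) φ ≤ φ ⬝ᵥ y + f y := by
    refine csSup_le (Set.Nonempty.image _ ⟨v, hv⟩) ?_
    rintro _ ⟨z, hz, rfl⟩
    simp only [sub_neg_eq_add]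
    rw [dotProduct_comm]
    exact hmax hz
  have h2 := hp.le_conjugate hy φ'
  rw [sub_dotProduct]
  linarith

/-! ### Online gradient ascent for the Euclidean norm -/

lemma euclideanNorm_sq_eq_dotProduct (x : Vec d) : euclideanNorm d x ^ 2 = x ⬝ᵥ x := by
  rw [euclideanNorm_sq, dotProduct]
  exact sum_congr rfl fun j _ => by ring

lemma euclideanNorm_definite (x : Vec d) (hx : euclideanNorm d x = 0) : x = 0 := by
  have := euclideanNorm_sq_eq_dotProduct x
  rw [hx] at this
  exact dotProduct_self_eq_zero.1 (by linarith)

lemma dotProduct_le_euclideanNorm_mul (x y : Vec d) :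
    x ⬝ᵥ y ≤ euclideanNorm d x * euclideanNorm d y := by
  have h : (x ⬝ᵥ y) ^ 2 ≤ (euclideanNorm d x * euclideanNorm d y) ^ 2 := by
    rw [mul_pow, euclideanNorm_sq, euclideanNorm_sq]
    exact sum_mul_sq_le_sq_mul_sq _ _ _
  exact (le_abs_self _).trans (abs_le_of_sq_le_sq h
    (mul_nonneg (apply_nonneg _ _) (apply_nonneg _ _)))

lemma mem_dualBall_euclideanNorm {r : ℝ} (hr : 0 ≤ r) {θ : Vec d} :
    θ ∈ dualBall (euclideanNorm d) r ↔ euclideanNorm d θ ≤ r := by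
  rw [mem_dualBall_iff euclideanNorm_definite hr]
  constructor
  · intro h
    have h1 := h θ
    rw [← euclideanNorm_sq_eq_dotProduct] at h1
    by_contra h2
    push Not at h2
    nlinarith
  · intro h x
    have h1 := dotProduct_le_euclideanNorm_mul x θ
    have h2 := mul_le_mul_of_nonneg_left h (apply_nonneg (euclideanNorm d) x)
    linarith

/-- The projection onto the Euclidean unit ball. -/
def ballProj (x : Vec d) : Vec d := (max 1 (euclideanNorm d x))⁻¹ • x

lemma euclideanNorm_ballProj_le (x : Vec d) : euclideanNorm d (ballProj x) ≤ 1 := by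
  have h : 0 < max 1 (euclideanNorm d x) := lt_max_of_lt_left one_pos
  rw [ballProj, map_smul_eq_mul, Real.norm_of_nonneg (by positivity), inv_mul_le_iff₀ h]
  simp

lemma sq_ballProj_sub_le (x : Vec d) {u : Vec d} (hu : euclideanNorm d u ≤ 1) :
    (ballProj x - u) ⬝ᵥ (ballProj x - u) ≤ (x - u) ⬝ᵥ (x - u) := by
  rw [ballProj]
  rcases le_total (euclideanNorm d x) 1 with h | h
  · simp [max_eq_left h]
  · rw [max_eq_right h]
    have h0 : 0 < euclideanNorm d x := by linarith
    have h1 := dotProduct_le_euclideanNorm_mul x u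
    have h2 := euclideanNorm_sq_eq_dotProduct x
    set n := euclideanNorm d x with hn
    simp only [sub_dotProduct, dotProduct_sub, smul_dotProduct, dotProduct_smul, smul_eq_mul,
      ← h2, dotProduct_comm u x]
    have h3 : n * euclideanNorm d u ≤ n := mul_le_of_le_one_right h0.le hu
    have h4 : n⁻¹ * (n⁻¹ * n ^ 2) = 1 := by field_simp
    have h5 : n⁻¹ ≤ 1 := inv_le_one_of_one_le₀ h
    have h6 : (1 - n⁻¹) * (x ⬝ᵥ u) ≤ (1 - n⁻¹) * n :=
      mul_le_mul_of_nonneg_left (h1.trans h3) (by linarith)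
    have h7 : (1 - n⁻¹) * n = n - 1 := by field_simp
    nlinarith

/-- Projected online gradient ascent on the Euclidean unit ball. -/
def gradientAscent (η : ℝ) : List (Vec d) → Vec d
  | [] => 0
  | G :: Gs => ballProj (gradientAscent η Gs + η • G)

lemma euclideanNorm_gradientAscent_le (η : ℝ) (Gs : List (Vec d)) :
    euclideanNorm d (gradientAscent η Gs) ≤ 1 := by
  cases Gs with
  | nil => simp [gradientAscent]
  | cons G Gs => exact euclideanNorm_ballProj_le _

/-- The squared distance to the comparator is the potential: a step changes it by at most `2η (θ -
u) · G + η² |G|²`, where `|G|² ≤ d`, and projection does not increase it. -/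
lemma gradientAscent_regret {η : ℝ} {Gs : List (Vec d)} (hGs : ∀ G ∈ Gs, ∀ j, |G j| ≤ 1)
    {u : Vec d} (hu : euclideanNorm d u ≤ 1) :
    2 * η * (u ⬝ᵥ Gs.sum - linearPayoff (gradientAscent η) Gs) +
      (gradientAscent η Gs - u) ⬝ᵥ (gradientAscent η Gs - u) ≤ 1 + Gs.length * (η ^ 2 * d) := by
  induction Gs with
  | nil =>
    have h1 := euclideanNorm_sq_eq_dotProduct u
    have h2 := apply_nonneg (euclideanNorm d) u
    simp only [gradientAscent, linearPayoff, List.sum_nil, dotProduct_zero, zero_sub,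
      neg_dotProduct, dotProduct_neg, neg_neg, List.length_nil, Nat.cast_zero]
    nlinarith
  | cons G Gs ih =>
    have h1 := ih fun G' h => hGs G' (by simp [h])
    have h2 := sq_ballProj_sub_le (gradientAscent η Gs + η • G) hu
    have h3 : G ⬝ᵥ G ≤ d := by
      rw [dotProduct]
      refine (sum_le_sum (g := fun _ => (1 : ℝ)) fun j _ => ?_).trans (by simp)
      have := hGs G (by simp) j
      rw [abs_le] at this
      nlinarith
    have h4 : gradientAscent η Gs + η • G - u = (gradientAscent η Gs - u) + η • G := by abel
    rw [h4] at h2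
    simp only [add_dotProduct, dotProduct_add, smul_dotProduct, dotProduct_smul, smul_eq_mul] at h2
    have h5 : G ⬝ᵥ (gradientAscent η Gs - u) = gradientAscent η Gs ⬝ᵥ G - u ⬝ᵥ G := by
      rw [dotProduct_comm, sub_dotProduct]
    have h6 : (gradientAscent η Gs - u) ⬝ᵥ G = gradientAscent η Gs ⬝ᵥ G - u ⬝ᵥ G :=
      sub_dotProduct _ _ _
    rw [h5, h6] at h2
    have h7 : η * (η * (G ⬝ᵥ G)) ≤ η ^ 2 * d := by nlinarith [sq_nonneg η]
    rw [List.sum_cons, dotProduct_add, linearPayoff, gradientAscent, List.length_cons]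
    push_cast
    linarith

lemma exists_isLinearLearner_euclideanNorm (hd : 2 ≤ d) {T : ℕ} (hT : 1 ≤ T) :
    ∃ base, IsLinearLearner (euclideanNorm d) T (Real.sqrt (d * T)) base := by
  have hq : 0 < Real.sqrt (d * T) := Real.sqrt_pos.2 (by positivity)
  -- This step size makes the accumulated term `T η² d` equal to `1`, the bound on the initial
  -- potential.
  refine ⟨gradientAscent (Real.sqrt (d * T))⁻¹, fun Gs => ?_, fun Gs hlen hGs u hu => ?_⟩
  · exact (mem_dualBall_euclideanNorm zero_le_one).2 (euclideanNorm_gradientAscent_le _ _)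
  · have h1 := gradientAscent_regret (η := (Real.sqrt (d * T))⁻¹) hGs
      ((mem_dualBall_euclideanNorm zero_le_one).1 hu)
    have h2 : 0 ≤ (gradientAscent (Real.sqrt (d * T))⁻¹ Gs - u) ⬝ᵥ
      (gradientAscent (Real.sqrt (d * T))⁻¹ Gs - u) := sum_nonneg fun j _ => mul_self_nonneg _
    have h3 : (Gs.length : ℝ) * ((Real.sqrt (d * T))⁻¹ ^ 2 * d) = 1 := by
      rw [hlen, inv_pow, Real.sq_sqrt (by positivity)]
      have : (d : ℝ) ≠ 0 := by positivity
      have : (T : ℝ) ≠ 0 := by positivity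
      field_simp
    rw [h3] at h1
    have h4 : 2 * (Real.sqrt (d * T))⁻¹ *
        (u ⬝ᵥ Gs.sum - linearPayoff (gradientAscent (Real.sqrt (d * T))⁻¹) Gs) ≤ 2 := by linarith
    rw [mul_assoc, mul_comm] at h4
    have h5 := (le_div_iff₀ two_pos).2 h4
    rw [inv_mul_le_iff₀ hq] at h5
    linarith

/-! ### Exponentiated gradient for the sup norm -/

lemma supNorm_definite (x : Vec d) (hx : supNorm d x = 0) : x = 0 := norm_eq_zero.1 hx

lemma mem_dualBall_supNorm_of_sum_le {θ : Vec d} (h : ∑ j, |θ j| ≤ 1) :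
    θ ∈ dualBall (supNorm d) 1 := by
  rw [mem_dualBall_iff supNorm_definite zero_le_one]
  intro x
  refine (le_abs_self _).trans ((abs_dotProduct_le x θ).trans ?_)
  rw [one_mul]
  exact mul_le_of_le_one_right (norm_nonneg _) h

/-- The exponentiated gradient learner over the cross-polytope. -/
def exponentiatedGradient (η : ℝ) (Gs : List (Vec d)) : Vec d :=
  fun j => Real.sinh (η * Gs.sum j) / ∑ k, Real.cosh (η * Gs.sum k)

/-- Comes from `exp b ≤ 1 + b + b ^ 2`, applied to `b` and `-b`. -/
lemma cosh_add_le (a : ℝ) {b : ℝ} (hb : |b| ≤ 1) :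
    Real.cosh (a + b) ≤ Real.cosh a * (1 + b ^ 2) + Real.sinh a * b := by
  have h1 := (le_abs_self _).trans (Real.abs_exp_sub_one_sub_id_le hb)
  have h2 := (le_abs_self _).trans (Real.abs_exp_sub_one_sub_id_le (x := -b) (by rwa [abs_neg]))
  rw [Real.cosh_eq, Real.cosh_eq, Real.sinh_eq, neg_add, Real.exp_add, Real.exp_add]
  nlinarith [Real.exp_pos a, Real.exp_pos (-a)]

/-- The sum of the `cosh` is, up to a factor `2`, the total weight of the `2d` vertices of the
cross-polytope. A round multiplies it by at most `1 + η² + η q`, where `q` is the payoff of the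
round, because the decision is the `sinh` vector divided by that sum. -/
lemma exponentiatedGradient_potential (hd : 1 ≤ d) {η : ℝ} (h0 : 0 ≤ η) (h1 : η ≤ 1)
    {Gs : List (Vec d)} (hGs : ∀ G ∈ Gs, ∀ j, |G j| ≤ 1) :
    ∑ k, Real.cosh (η * Gs.sum k) ≤
      d * Real.exp (Gs.length * η ^ 2 + η * linearPayoff (exponentiatedGradient η) Gs) := by
  have : Nonempty (Fin d) := ⟨⟨0, hd⟩⟩
  induction Gs with
  | nil => simp [linearPayoff]
  | cons G Gs ih =>
    have ih := ih fun G' h => hGs G' (by simp [h])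
    have hW : 0 < ∑ k, Real.cosh (η * Gs.sum k) :=
      sum_pos (fun k _ => Real.cosh_pos _) univ_nonempty
    set W := ∑ k, Real.cosh (η * Gs.sum k) with hWdef
    have h2 : ∀ k ∈ (univ : Finset (Fin d)), Real.cosh (η * (G :: Gs).sum k) ≤
        Real.cosh (η * Gs.sum k) * (1 + η ^ 2) +
          W * η * (exponentiatedGradient η Gs k * G k) := by
      intro k _
      have hG := hGs G (by simp) k
      have h3 : |η * G k| ≤ 1 := by
        rw [abs_mul, abs_of_nonneg h0]
        nlinarith [abs_nonneg (G k)]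
      have h4 := cosh_add_le (η * Gs.sum k) h3
      have h5 : η * (G :: Gs).sum k = η * Gs.sum k + η * G k := by
        rw [List.sum_cons, Pi.add_apply]; ring
      rw [h5]
      refine h4.trans ?_
      have h6 : W * η * (exponentiatedGradient η Gs k * G k) =
          Real.sinh (η * Gs.sum k) * (η * G k) := by
        rw [exponentiatedGradient, ← hWdef]
        field_simp
      rw [h6]
      have h7 : (η * G k) ^ 2 ≤ η ^ 2 := by
        rw [mul_pow]
        refine mul_le_of_le_one_right (sq_nonneg _) ?_
        rwa [sq_le_one_iff_abs_le_one]
      nlinarith [Real.cosh_pos (η * Gs.sum k)]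
    refine (sum_le_sum h2).trans ?_
    rw [sum_add_distrib, ← sum_mul, ← mul_sum, ← hWdef]
    have h8 : ∑ k, exponentiatedGradient η Gs k * G k = exponentiatedGradient η Gs ⬝ᵥ G := rfl
    rw [h8, linearPayoff, List.length_cons]
    set q := exponentiatedGradient η Gs ⬝ᵥ G with hq
    have h9 : W * (1 + η ^ 2) + W * η * q ≤ W * Real.exp (η ^ 2 + η * q) := by
      have := mul_le_mul_of_nonneg_left (Real.add_one_le_exp (η ^ 2 + η * q)) hW.le
      linarith
    refine h9.trans ((mul_le_mul_of_nonneg_right ih (Real.exp_pos _).le).trans (le_of_eq ?_))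
    rw [mul_assoc, ← Real.exp_add]
    push_cast
    ring_nf

lemma exp_abs_le_two_mul_cosh (x : ℝ) : Real.exp |x| ≤ 2 * Real.cosh x := by
  rw [Real.cosh_eq]
  rcases abs_cases x with h | h <;> rw [h.1] <;>
    linarith [Real.exp_pos x, Real.exp_pos (-x)]

/-- The largest coordinate of the gradient sum is read off from the potential through `exp |x| ≤ 2
cosh x`; by duality its absolute value is the best payoff in hindsight. -/
lemma exponentiatedGradient_regret (hd : 2 ≤ d) {η : ℝ} (h0 : 0 < η) (h1 : η ≤ 1)
    {Gs : List (Vec d)} (hGs : ∀ G ∈ Gs, ∀ j, |G j| ≤ 1) :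
    η * ‖Gs.sum‖ ≤ Real.log (2 * d) + Gs.length * η ^ 2 +
      η * linearPayoff (exponentiatedGradient η) Gs := by
  have hne : Nonempty (Fin d) := ⟨⟨0, by omega⟩⟩
  have h2 := exponentiatedGradient_potential (by omega : 1 ≤ d) h0.le h1 hGs
  obtain ⟨j, hj⟩ := Finite.exists_max (fun j => ‖Gs.sum j‖)
  have h3 : ‖Gs.sum‖ ≤ |Gs.sum j| := (pi_norm_le_iff_of_nonneg (norm_nonneg _)).2 hj
  have h4 : Real.cosh (η * Gs.sum j) ≤ ∑ k, Real.cosh (η * Gs.sum k) :=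
    single_le_sum (f := fun k => Real.cosh (η * Gs.sum k)) (fun k _ => (Real.cosh_pos _).le)
      (mem_univ j)
  have h5 := exp_abs_le_two_mul_cosh (η * Gs.sum j)
  have h6 : Real.exp |η * Gs.sum j| ≤ Real.exp (Real.log (2 * d) +
      (Gs.length * η ^ 2 + η * linearPayoff (exponentiatedGradient η) Gs)) := by
    rw [Real.exp_add, Real.exp_log (by positivity)]
    linarith
  have h7 := Real.exp_le_exp.1 h6
  rw [abs_mul, abs_of_pos h0] at h7
  have h8 := mul_le_mul_of_nonneg_left h3 h0.le
  linarith

lemma sum_abs_exponentiatedGradient_le (η : ℝ) (Gs : List (Vec d)) :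
    ∑ j, |exponentiatedGradient η Gs j| ≤ 1 := by
  simp only [exponentiatedGradient, abs_div]
  rw [← sum_div]
  have h0 : 0 ≤ ∑ k, Real.cosh (η * Gs.sum k) := sum_nonneg fun k _ => (Real.cosh_pos _).le
  rw [abs_of_nonneg h0]
  refine div_le_one_of_le₀ (sum_le_sum fun j _ => ?_) h0
  rw [abs_le]
  constructor
  · have := Real.cosh_add_sinh (η * Gs.sum j)
    linarith [Real.exp_pos (η * Gs.sum j)]
  · have := Real.cosh_sub_sinh (η * Gs.sum j)
    linarith [Real.exp_pos (-(η * Gs.sum j))]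

lemma norm_list_sum_le {Gs : List (Vec d)} (hGs : ∀ G ∈ Gs, ∀ j, |G j| ≤ 1) :
    ‖Gs.sum‖ ≤ Gs.length := by
  induction Gs with
  | nil => simp
  | cons G Gs ih =>
    have h1 := ih fun G' h => hGs G' (by simp [h])
    have h2 : ‖G‖ ≤ 1 := (pi_norm_le_iff_of_nonneg zero_le_one).2 (hGs G (by simp))
    rw [List.sum_cons, List.length_cons]
    push_cast
    linarith [norm_add_le G Gs.sum]

lemma exists_isLinearLearner_supNorm (hd : 2 ≤ d) {T : ℕ} (hT : 1 ≤ T) :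
    ∃ base, IsLinearLearner (supNorm d) T (3 * Real.sqrt (Real.log d * T)) base := by
  have hT' : (0 : ℝ) < T := by exact_mod_cast hT
  have hl := half_le_log hd
  have hsup : ∀ (Gs : List (Vec d)), ∀ u ∈ dualBall (supNorm d) 1, u ⬝ᵥ Gs.sum ≤ ‖Gs.sum‖ := by
    intro Gs u hu
    rw [mem_dualBall_iff supNorm_definite zero_le_one] at hu
    have := hu Gs.sum
    rw [one_mul, dotProduct_comm] at this
    exact this
  -- The step size `√(log d / T)` is admissible only if it is at most `1`. Otherwise `T < √(T log
  -- d)`, and never moving from `0` is good enough.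
  by_cases hcase : Real.log d ≤ T
  · set η := Real.sqrt (Real.log d / T) with hη
    have hη0 : 0 < η := Real.sqrt_pos.2 (by positivity)
    have hη1 : η ≤ 1 := Real.sqrt_le_one.2 ((div_le_one hT').2 hcase)
    have hη2 : η ^ 2 = Real.log d / T := Real.sq_sqrt (by positivity)
    have hη3 : η * Real.sqrt (Real.log d * T) = Real.log d := by
      rw [hη, ← Real.sqrt_mul (by positivity)]
      have : Real.log d / T * (Real.log d * T) = Real.log d ^ 2 := by field_simp
      rw [this, Real.sqrt_sq (by linarith)]
    refine ⟨exponentiatedGradient η, fun Gs => ?_, fun Gs hlen hGs u hu => ?_⟩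
    · exact mem_dualBall_supNorm_of_sum_le (sum_abs_exponentiatedGradient_le η Gs)
    · have h1 := exponentiatedGradient_regret hd hη0 hη1 hGs
      have h2 := hsup Gs u hu
      have h3 : (T : ℝ) * η ^ 2 = Real.log d := by rw [hη2]; field_simp
      rw [hlen, h3] at h1
      have h4 := log_two_mul_le hd
      have h5 := mul_le_mul_of_nonneg_left h2 hη0.le
      refine le_of_mul_le_mul_left ?_ hη0
      linarith
  · push Not at hcase
    refine ⟨fun _ => 0, fun _ => zero_mem_dualBall zero_le_one, fun Gs hlen hGs u hu => ?_⟩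
    have h1 : linearPayoff (fun _ => (0 : Vec d)) Gs = 0 := by
      clear hlen hGs
      induction Gs with
      | nil => rfl
      | cons G Gs ih => simp [linearPayoff, ih]
    have h2 := (hsup Gs u hu).trans (norm_list_sum_le hGs)
    rw [hlen] at h2
    rw [h1, sub_zero]
    have h3 : (T : ℝ) ≤ Real.sqrt (Real.log d * T) := by
      apply Real.le_sqrt_of_sq_le
      rw [sq]
      exact mul_le_mul_of_nonneg_right hcase.le hT'.le
    linarith

end learners

/-! ### Sums along the prefixes of a permutation -/

/-- The sum of `u I i` over the steps at which `i` is put in front of the list `I`. -/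
def stepSum {α β : Type*} [AddCommMonoid β] (u : List α → α → β) : List α → β
  | [] => 0
  | i :: I => stepSum u I + u I i

lemma stepSum_reverse_ofFn {α β : Type*} [AddCommMonoid β] (u : List α → α → β) {n : ℕ}
    (g : Fin n → α) :
    stepSum u (List.ofFn g).reverse = ∑ t : Fin n, u ((List.ofFn g).take t).reverse (g t) := by
  induction n with
  | zero => simp [stepSum]
  | succ n ih =>
    have h1 : List.ofFn g = List.ofFn (fun i : Fin n => g i.castSucc) ++ [g (Fin.last n)] := by
      rw [List.ofFn_succ', List.concat_eq_append]
    rw [Fin.sum_univ_castSucc, h1, List.reverse_append, List.reverse_singleton,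
      List.singleton_append, stepSum, ih]
    congr 1
    · refine sum_congr rfl fun t _ => ?_
      rw [List.take_append_of_le_length (by simp [t.2.le])]
      rfl
    · rw [List.take_append_of_le_length (by simp), List.take_of_length_le (by simp)]

lemma take_ofFn_congr {α : Type*} {n : ℕ} {g h : Fin n → α} {t : ℕ}
    (hgh : ∀ i : Fin n, i.1 < t → g i = h i) : (List.ofFn g).take t = (List.ofFn h).take t := by
  apply List.ext_getElem
  · simp
  · intro i h1 h2
    simp only [List.getElem_take, List.getElem_ofFn]
    refine hgh _ ?_
    simp only [List.length_take, List.length_ofFn, lt_min_iff] at h1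
    exact h1.1

/-- Decisions that depend only on the past gain, against a randomly permuted sequence, at most
their dual norm times the mean deviation of the unseen part. -/
lemma permExp_stepSum_le {d T : ℕ} (N : Seminorm ℝ (Vec d)) {r : ℝ}
    {c : List (Fin T) → Vec d} (hc : ∀ I x, x ⬝ᵥ c I ≤ r * N x) (w : Fin T → Vec d) :
    permExp (fun π : Equiv.Perm (Fin T) =>
      stepSum (fun I i => (w i - average w) ⬝ᵥ c I) (List.ofFn π).reverse) ≤
      r * ∑ t : Fin T, meanDeviation N w (Ici t) := by
  simp only [stepSum_reverse_ofFn]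
  rw [permExp_sum, mul_sum]
  refine sum_le_sum fun t _ => ?_
  have hM : (0 : ℝ) < #(Ici t) := by
    exact_mod_cast card_pos.2 ⟨t, mem_Ici.2 le_rfl⟩
  -- Swapping positions `t` and `k ≥ t` does not touch the prefix that determines `c`. So position
  -- `t` may be replaced by any unseen position, and then by the mean over all of them.
  have h1 : ∀ k ∈ Ici t,
      permExp (fun π : Equiv.Perm (Fin T) =>
        (w (π k) - average w) ⬝ᵥ c ((List.ofFn π).take t).reverse) =
      permExp (fun π => (w (π t) - average w) ⬝ᵥ c ((List.ofFn π).take t).reverse) := by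
    intro k hk
    rw [← permExp_comp_mul (Equiv.swap t k)]
    congr 1
    ext π
    have h2 : (List.ofFn (π * Equiv.swap t k)).take t = (List.ofFn π).take t := by
      refine take_ofFn_congr fun i hi => ?_
      have hit : i < t := hi
      rw [Equiv.Perm.mul_apply, Equiv.swap_apply_of_ne_of_ne hit.ne
        (hit.trans_le (mem_Ici.1 hk)).ne]
    rw [h2, Equiv.Perm.mul_apply, Equiv.swap_apply_right]
  have h3 := sum_congr (rfl : Ici t = Ici t) h1
  rw [sum_const, nsmul_eq_mul, ← permExp_sum] at h3
  rw [← mul_le_mul_iff_of_pos_left hM, ← h3, meanDeviation_eq]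
  have h4 : (#(Ici t) : ℝ) * (r * ((#(Ici t) : ℝ)⁻¹ *
      permExp fun π => N (∑ k ∈ Ici t, (w (π k) - average w)))) =
      r * permExp fun π => N (∑ k ∈ Ici t, (w (π k) - average w)) := by
    field_simp
  rw [h4, ← permExp_mul_left]
  refine permExp_mono fun π => ?_
  rw [← sum_dotProduct]
  exact hc _ _

/-! ### The algorithm -/

section algorithm

variable {d T : ℕ} {N : Seminorm ℝ (Vec d)} {f : Vec d → ℝ} {S : Set (Vec d)} {L Z : ℝ}
  {A B : Learner d} {sel : List (Set (Vec d)) → Vec d → Vec d} {X : Fin T → Set (Vec d)}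

lemma playsOn_eq (π : Equiv.Perm (Fin T)) :
    playsOn f S L Z A B sel X π =
      plays f S L Z A B sel ((List.ofFn π).reverse.map X) := by
  rw [playsOn, List.map_reverse, List.map_ofFn]
  rfl

lemma length_plays (Ys : List (Set (Vec d))) :
    (plays f S L Z A B sel Ys).length = Ys.length := by
  induction Ys with
  | nil => rfl
  | cons Y Ys ih => simp [plays, ih]

lemma length_playsOn (π : Equiv.Perm (Fin T)) :
    (playsOn f S L Z A B sel X π).length = T := by
  simp [playsOn, length_plays]

lemma mem_cube_of_mem_plays (hX : IsInstance S X) (hsel : IsArgmaxRule X sel)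
    (I : List (Fin T)) : ∀ v ∈ plays f S L Z A B sel (I.map X), v ∈ cube d := by
  induction I with
  | nil => simp [plays]
  | cons i I ih =>
    intro v hv
    rw [List.map_cons, plays, List.mem_cons] at hv
    rcases hv with rfl | hv
    · exact hX.subset_cube i (hsel i _ _).1
    · exact ih v hv

lemma sum_plays (I : List (Fin T)) :
    (plays f S L Z A B sel (I.map X)).sum =
      stepSum (fun I i => sel (X i :: I.map X)
        (-B ((plays f S L Z A B sel (I.map X)).map (objectivePayoff f)) -
          (2 * (Z + L)) • A ((plays f S L Z A B sel (I.map X)).map (constraintPayoff S)))) I := by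
  induction I with
  | nil => rfl
  | cons i I ih => rw [List.map_cons, plays, List.sum_cons, ih, stepSum, add_comm]

/-- The played average is the average of an admissible choice of vectors. -/
lemma exists_playedAverage_eq (hsel : IsArgmaxRule X sel) (π : Equiv.Perm (Fin T)) :
    ∃ v : Fin T → Vec d, (∀ i, v i ∈ X i) ∧ playedAverage f S L Z A B sel X π = average v := by
  have key : ∀ u : List (Fin T) → Fin T → Vec d, (∀ I i, u I i ∈ X i) →
      ∃ v : Fin T → Vec d, (∀ i, v i ∈ X i) ∧
        (T : ℝ)⁻¹ • stepSum u (List.ofFn π).reverse = average v := by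
    intro u hu
    -- The set with index `i` arrives at step `π.symm i`, after the prefix of that length.
    refine ⟨fun i => u ((List.ofFn π).take (π.symm i)).reverse i, fun i => hu _ i, ?_⟩
    rw [stepSum_reverse_ofFn, average]
    congr 1
    rw [← Equiv.sum_comp π (fun i => u ((List.ofFn π).take (π.symm i)).reverse i)]
    simp only [Equiv.symm_apply_apply]
  rw [playedAverage, playsOn_eq, sum_plays]
  exact key _ fun I i => (hsel i _ _).1

lemma playedAverage_mem_cube (hT : 1 ≤ T) (hX : IsInstance S X) (hsel : IsArgmaxRule X sel)
    (π : Equiv.Perm (Fin T)) : playedAverage f S L Z A B sel X π ∈ cube d := by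
  obtain ⟨v, hv, h⟩ := exists_playedAverage_eq (f := f) (S := S) (L := L) (Z := Z) (A := A)
    (B := B) hsel π
  rw [h]
  exact average_mem_cube hT fun i => hX.subset_cube i (hv i)

/-- Comparison of the payoffs of the learners with a fixed admissible choice `w`. -/
lemma learnerPayoff_add_le (hp : IsProblem N f S L) (hZ : 0 ≤ Z) (hsel : IsArgmaxRule X sel)
    {w : Fin T → Vec d} (hw : ∀ i, w i ∈ X i) (hwS : average w ∈ S) (I : List (Fin T)) :
    learnerPayoff B ((plays f S L Z A B sel (I.map X)).map (objectivePayoff f)) +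
      2 * (Z + L) *
        learnerPayoff A ((plays f S L Z A B sel (I.map X)).map (constraintPayoff S)) ≤
      stepSum (fun I i => (w i - average w) ⬝ᵥ
        (B ((plays f S L Z A B sel (I.map X)).map (objectivePayoff f)) +
          (2 * (Z + L)) • A ((plays f S L Z A B sel (I.map X)).map (constraintPayoff S)))) I -
        I.length * f (average w) := by
  induction I with
  | nil => simp [plays, learnerPayoff, stepSum]
  | cons i I ih =>
    rw [List.map_cons, plays]
    simp only [List.map_cons, learnerPayoff, stepSum, List.length_cons]
    set φ := B ((plays f S L Z A B sel (I.map X)).map (objectivePayoff f)) with hφ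
    set θ := A ((plays f S L Z A B sel (I.map X)).map (constraintPayoff S)) with hθ
    -- Optimality of the played vector against `w i`. Then `h2` and `h3` evaluate the two payoffs at
    -- `average w`, using that it lies in `S`.
    have h1 := (hsel i (I.map X) (-φ - (2 * (Z + L)) • θ)).2 (w i) (hw i)
    set v := sel (X i :: I.map X) (-φ - (2 * (Z + L)) • θ) with hv
    have h2 := hp.le_conjugate (hp.subset_cube hwS) φ
    have h3 := dotProduct_le_supportFn hp.subset_cube hwS θ
    have h4 : 0 ≤ 2 * (Z + L) := by linarith [hp.nonneg]
    have h5 := mul_le_mul_of_nonneg_left h3 h4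
    have h6 : (w i - average w) ⬝ᵥ (φ + (2 * (Z + L)) • θ) =
        φ ⬝ᵥ w i + 2 * (Z + L) * (θ ⬝ᵥ w i) -
          (φ ⬝ᵥ average w + 2 * (Z + L) * (θ ⬝ᵥ average w)) := by
      rw [dotProduct_comm]
      simp only [add_dotProduct, smul_dotProduct, dotProduct_sub, smul_eq_mul]
    rw [h6]
    simp only [sub_dotProduct, neg_dotProduct, smul_dotProduct, smul_eq_mul] at h1
    simp only [objectivePayoff, constraintPayoff] at ih ⊢
    push_cast
    linarith

lemma sum_constraintPayoff (θ : Vec d) (vs : List (Vec d)) :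
    ((vs.map (constraintPayoff S)).map (fun g => g θ)).sum =
      θ ⬝ᵥ vs.sum - vs.length * supportFn S θ := by
  induction vs with
  | nil => simp
  | cons v vs ih =>
    simp only [List.map_cons, List.sum_cons, ih, constraintPayoff, dotProduct_add,
      List.length_cons]
    push_cast
    ring

lemma sum_objectivePayoff (φ : Vec d) (vs : List (Vec d)) :
    ((vs.map (objectivePayoff f)).map (fun g => g φ)).sum =
      φ ⬝ᵥ vs.sum - vs.length * conjugate (fun y => -f y) φ := by
  induction vs with
  | nil => simp
  | cons v vs ih =>
    simp only [List.map_cons, List.sum_cons, ih, objectivePayoff, dotProduct_add,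
      List.length_cons]
    push_cast
    ring

/-- Regret plus payoff is the best total in hindsight, which is `T` times the supremum of `θ · v_avg
- h_S(θ)`. Its boundedness has to be shown, since `sSup` of an unbounded set would be `0`. -/
lemma mul_distTo_le_ocoRegret (hN : ∀ x, N x = 0 → x = 0) (hp : IsProblem N f S L)
    (hT : 1 ≤ T) {vs : List (Vec d)} (hvs : vs.length = T) :
    T * distTo N ((T : ℝ)⁻¹ • vs.sum) S ≤
      ocoRegret (dualBall N 1) A (vs.map (constraintPayoff S)) +
        learnerPayoff A (vs.map (constraintPayoff S)) := by
  have hT' : (0 : ℝ) < T := by exact_mod_cast hT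
  rw [ocoRegret, sub_add_cancel]
  obtain ⟨θ, h1, h2⟩ := exists_distTo_le (N := N) hp.nonempty hp.convex ((T : ℝ)⁻¹ • vs.sum)
  obtain ⟨y, hy⟩ := hp.nonempty
  have hbdd : BddAbove ((fun θ => ((vs.map (constraintPayoff S)).map (fun g => g θ)).sum) ''
      dualBall N 1) := by
    refine ⟨1 * N (vs.sum - (T : ℝ) • y), ?_⟩
    rintro _ ⟨θ, hθ, rfl⟩
    rw [mem_dualBall_iff hN zero_le_one] at hθ
    refine le_trans ?_ (hθ _)
    simp only [sum_constraintPayoff]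
    rw [sub_dotProduct, smul_dotProduct, dotProduct_comm, dotProduct_comm y, hvs, smul_eq_mul]
    have := mul_le_mul_of_nonneg_left (dotProduct_le_supportFn hp.subset_cube hy θ) hT'.le
    linarith
  refine le_trans ?_ (le_csSup hbdd ⟨θ, (mem_dualBall_iff hN zero_le_one).2 h1, rfl⟩)
  simp only [sum_constraintPayoff]
  rw [hvs]
  have h3 := mul_le_mul_of_nonneg_left h2 hT'.le
  rw [dotProduct_smul, smul_eq_mul, mul_sub, mul_inv_cancel_left₀ hT'.ne'] at h3
  exact h3

/-- The counterpart for the objective, by biconjugation of `-f` on the ball of radius `L`. -/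
lemma neg_mul_le_ocoRegret (hN : ∀ x, N x = 0 → x = 0) (hp : IsProblem N f S L)
    (hT : 1 ≤ T) {vs : List (Vec d)} (hvs : vs.length = T)
    (havg : (T : ℝ)⁻¹ • vs.sum ∈ cube d) :
    -(T * f ((T : ℝ)⁻¹ • vs.sum)) ≤
      ocoRegret (dualBall N L) B (vs.map (objectivePayoff f)) +
        learnerPayoff B (vs.map (objectivePayoff f)) := by
  have hT' : (0 : ℝ) < T := by exact_mod_cast hT
  rw [ocoRegret, sub_add_cancel]
  obtain ⟨φ, h1, h2⟩ := hp.exists_neg_le havg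
  have hbdd : BddAbove ((fun θ => ((vs.map (objectivePayoff f)).map (fun g => g θ)).sum) ''
      dualBall N L) := by
    refine ⟨L * N vs.sum - T * f 0, ?_⟩
    rintro _ ⟨φ, hφ, rfl⟩
    rw [mem_dualBall_iff hN hp.nonneg] at hφ
    have h3 := hφ vs.sum
    have h4 := hp.le_conjugate (y := 0) ⟨le_rfl, zero_le_one⟩ φ
    rw [dotProduct_zero, zero_add] at h4
    simp only [sum_objectivePayoff]
    rw [dotProduct_comm, hvs]
    have := mul_le_mul_of_nonneg_left h4 hT'.le
    linarith
  refine le_trans ?_ (le_csSup hbdd ⟨φ, (mem_dualBall_iff hN hp.nonneg).2 h1, rfl⟩)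
  simp only [sum_objectivePayoff]
  rw [hvs]
  have h3 := mul_le_mul_of_nonneg_left h2 hT'.le
  rw [dotProduct_smul, smul_eq_mul, mul_sub, mul_inv_cancel_left₀ hT'.ne'] at h3
  linarith

lemma bddAbove_values (hp : IsProblem N f S L) (hT : 1 ≤ T) (hX : IsInstance S X)
    (p : Vec d → Prop) :
    BddAbove {r | ∃ v : Fin T → Vec d, (∀ i, v i ∈ X i) ∧ p (average v) ∧ r = f (average v)} := by
  obtain ⟨C, hC⟩ := hp.bddAbove
  refine ⟨C, ?_⟩
  rintro _ ⟨v, hv, -, rfl⟩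
  exact (le_abs_self _).trans (hC _ (average_mem_cube hT fun i => hX.subset_cube i (hv i)))

/-- The played average is admissible in the relaxed problem whose `δ` is its own distance to `S`. -/
lemma objective_le_of_isTradeoff (hp : IsProblem N f S L) (hT : 1 ≤ T) (hX : IsInstance S X)
    (hZ : IsTradeoff N f S X Z) (hsel : IsArgmaxRule X sel) (π : Equiv.Perm (Fin T)) :
    f (playedAverage f S L Z A B sel X π) ≤
      offlineOpt f S X + Z * distTo N (playedAverage f S L Z A B sel X π) S := by
  obtain ⟨v, hv, h⟩ := exists_playedAverage_eq (f := f) (S := S) (L := L) (Z := Z) (A := A)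
    (B := B) hsel π
  rw [h]
  exact (le_csSup (bddAbove_values hp hT hX fun x => distTo N x S ≤ distTo N (average v) S)
    ⟨v, hv, le_rfl, rfl⟩).trans (hZ.bound _ (distTo_nonneg _ _ _))

/-- The weighted sum of the two expected regrets of the algorithm. -/
lemma objectiveRegret_add_le (hN : ∀ x, N x = 0 → x = 0) (hT : 1 ≤ T)
    (hp : IsProblem N f S L) (hA : ∀ gs, A gs ∈ dualBall N 1) (hB : ∀ gs, B gs ∈ dualBall N L)
    (hX : IsInstance S X) (hZ : 0 ≤ Z) (hsel : IsArgmaxRule X sel) {q : ℝ}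
    (hq : ∀ w : Fin T → Vec d, (∀ i, w i ∈ cube d) → average w ∈ S →
      ∑ t : Fin T, meanDeviation N w (Ici t) ≤ q) :
    T * (objectiveRegret f S L Z A B sel X +
        2 * (Z + L) * constraintRegret N f S L Z A B sel X) ≤
      learnerRegretφ N f S L Z A B sel X + 2 * (Z + L) * learnerRegretθ N f S L Z A B sel X +
        3 * (Z + L) * q := by
  have hT' : (0 : ℝ) < T := by exact_mod_cast hT
  have hL := hp.nonneg
  have hc : 0 ≤ 2 * (Z + L) := by linarith
  -- The offline optimum need not be attained, so the comparator `w` is optimal only up to `ε / T`.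
  refine le_of_forall_pos_le_add fun ε hε => ?_
  obtain ⟨w₀, hw₀, hw₀S⟩ := hX.feasible
  obtain ⟨_, ⟨w, hw, hwS, rfl⟩, hlt⟩ := exists_lt_of_lt_csSup
    (s := {r | ∃ v : Fin T → Vec d, (∀ i, v i ∈ X i) ∧ average v ∈ S ∧ r = f (average v)})
    ⟨_, w₀, hw₀, hw₀S, rfl⟩ (sub_lt_self (offlineOpt f S X) (div_pos hε hT'))
  have hdev := hq w (fun i => hX.subset_cube i (hw i)) hwS
  have hdev0 : 0 ≤ ∑ t : Fin T, meanDeviation N w (Ici t) :=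
    sum_nonneg fun t _ => permExp_nonneg fun π => apply_nonneg _ _
  set c : List (Fin T) → Vec d := fun I =>
    B ((plays f S L Z A B sel (I.map X)).map (objectivePayoff f)) +
      (2 * (Z + L)) • A ((plays f S L Z A B sel (I.map X)).map (constraintPayoff S)) with hcdef
  -- The dual norm is at most `L + 2 (Z + L) ≤ 3 (Z + L)`.
  have hcn : ∀ I x, x ⬝ᵥ c I ≤ 3 * (Z + L) * N x := by
    intro I x
    have h1 := (mem_dualBall_iff hN hL).1
      (hB ((plays f S L Z A B sel (I.map X)).map (objectivePayoff f))) x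
    have h2 := mul_le_mul_of_nonneg_left ((mem_dualBall_iff hN zero_le_one).1
      (hA ((plays f S L Z A B sel (I.map X)).map (constraintPayoff S))) x) hc
    rw [hcdef]
    simp only [dotProduct_add, dotProduct_smul, smul_eq_mul]
    have h3 : 0 ≤ Z * N x := mul_nonneg hZ (apply_nonneg _ _)
    linarith
  have hstep := permExp_stepSum_le N hcn w
  have hpt : ∀ π : Equiv.Perm (Fin T),
      T * (offlineOpt f S X - f (playedAverage f S L Z A B sel X π)) +
        2 * (Z + L) * (T * distTo N (playedAverage f S L Z A B sel X π) S) ≤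
      ocoRegret (dualBall N L) B ((playsOn f S L Z A B sel X π).map (objectivePayoff f)) +
        2 * (Z + L) *
          ocoRegret (dualBall N 1) A ((playsOn f S L Z A B sel X π).map (constraintPayoff S)) +
        (stepSum (fun I i => (w i - average w) ⬝ᵥ c I) (List.ofFn π).reverse + ε) := by
    intro π
    have h1 := mul_distTo_le_ocoRegret (A := A) hN hp hT
      (length_playsOn (f := f) (S := S) (L := L) (Z := Z) (A := A) (B := B) (sel := sel)
        (X := X) π)
    have h2 := neg_mul_le_ocoRegret (B := B) hN hp hT
      (length_playsOn (f := f) (S := S) (L := L) (Z := Z) (A := A) (B := B) (sel := sel)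
        (X := X) π) (playedAverage_mem_cube hT hX hsel π)
    have h3 := learnerPayoff_add_le (A := A) (B := B) hp hZ hsel hw hwS (List.ofFn π).reverse
    rw [← playsOn_eq, List.length_reverse, List.length_ofFn] at h3
    have h4 := mul_le_mul_of_nonneg_left h1 hc
    have h5 := mul_lt_mul_of_pos_left hlt hT'
    rw [mul_sub, mul_div_cancel₀ _ hT'.ne'] at h5
    rw [playedAverage]
    linarith
  have hE := permExp_mono hpt
  simp only [permExp_add, permExp_mul_left, permExp_const] at hE
  have h6 := mul_le_mul_of_nonneg_left hdev (by linarith : 0 ≤ 3 * (Z + L))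
  rw [objectiveRegret, constraintRegret, learnerRegretφ, learnerRegretθ]
  linarith

/-- Separates the weighted sum `O + 2(Z+L) D`. Dropping `D ≥ 0` bounds `O`. Since `O ≥ -Z D`, the
sum is also at least `(Z+L) D`; this is why the algorithm weighs the constraint by `2(Z+L)`. -/
lemma regret_le (hN : ∀ x, N x = 0 → x = 0) (hT : 1 ≤ T)
    (hp : IsProblem N f S L) (hA : ∀ gs, A gs ∈ dualBall N 1) (hB : ∀ gs, B gs ∈ dualBall N L)
    (hX : IsInstance S X) (hZ : IsTradeoff N f S X Z) (hsel : IsArgmaxRule X sel) {q : ℝ}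
    (hq : ∀ w : Fin T → Vec d, (∀ i, w i ∈ cube d) → average w ∈ S →
      ∑ t : Fin T, meanDeviation N w (Ici t) ≤ q) {R R' : ℝ}
    (hR : learnerRegretθ N f S L Z A B sel X ≤ R)
    (hR' : learnerRegretφ N f S L Z A B sel X ≤ R') :
    objectiveRegret f S L Z A B sel X ≤ (Z + L) / T * (2 * R + 3 * q) + R' / T ∧
      (0 < Z + L → constraintRegret N f S L Z A B sel X ≤
        1 / T * (2 * R + 3 * q) + 1 / (Z + L) * (R' / T)) := by
  have hT' : (0 : ℝ) < T := by exact_mod_cast hT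
  have hL := hp.nonneg
  have hc : 0 ≤ Z + L := by linarith [hZ.nonneg]
  have h1 := objectiveRegret_add_le hN hT hp hA hB hX hZ.nonneg hsel hq
  have h2 : 0 ≤ constraintRegret N f S L Z A B sel X :=
    permExp_nonneg fun π => distTo_nonneg _ _ _
  have h3 := mul_le_mul_of_nonneg_left hR (by linarith : 0 ≤ 2 * (Z + L))
  have h4 : -(Z * constraintRegret N f S L Z A B sel X) ≤ objectiveRegret f S L Z A B sel X := by
    have h5 := permExp_mono fun π => objective_le_of_isTradeoff (A := A) (B := B) hp hT hX hZ hsel π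
    rw [permExp_add, permExp_const, permExp_mul_left] at h5
    rw [objectiveRegret, permExp_sub, permExp_const, constraintRegret]
    linarith
  have h6 : 0 ≤ L * constraintRegret N f S L Z A B sel X := mul_nonneg hL h2
  set O := objectiveRegret f S L Z A B sel X
  set D := constraintRegret N f S L Z A B sel X
  have h7 : T * O ≤ (Z + L) * (2 * R + 3 * q) + R' := by
    have : 0 ≤ T * ((Z + L) * D) := by positivity
    linarith
  have h8 : T * ((Z + L) * D) ≤ (Z + L) * (2 * R + 3 * q) + R' := by
    have h9 : T * ((Z + L) * D) ≤ T * (O + 2 * (Z + L) * D) :=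
      mul_le_mul_of_nonneg_left (by linarith) hT'.le
    linarith
  constructor
  · have e1 : (Z + L) / T * (2 * R + 3 * q) + R' / T =
        ((Z + L) * (2 * R + 3 * q) + R') / T := by field_simp
    rw [e1, le_div_iff₀ hT']
    linarith
  · intro h0
    have e2 : 1 / T * (2 * R + 3 * q) + 1 / (Z + L) * (R' / T) =
        ((Z + L) * (2 * R + 3 * q) + R') / (T * (Z + L)) := by field_simp
    rw [e2, le_div_iff₀ (by positivity)]
    linarith

/-! ### The random permutation gap and the explicit rates. -/

lemma le_maxCoord (hS : S ⊆ cube d) {v : Vec d} (hv : v ∈ S) (j : Fin d) : v j ≤ maxCoord S :=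
  le_csSup ⟨1, by rintro _ ⟨u, hu, i, rfl⟩; exact (hS hu).2 i⟩ ⟨v, hv, j, rfl⟩

lemma supNorm_one (hd : 1 ≤ d) : supNorm d 1 = 1 := by
  have : Nonempty (Fin d) := ⟨⟨0, hd⟩⟩
  exact (norm_one : ‖(1 : Fin d → ℝ)‖ = 1)

lemma euclideanNorm_le_mul_supNorm (x : Vec d) :
    euclideanNorm d x ≤ euclideanNorm d 1 * supNorm d x := by
  have h0 : (0 : ℝ) ≤ supNorm d x := apply_nonneg _ _
  rw [euclideanNorm_one]
  refine le_of_sq_le_sq ?_ (by positivity)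
  rw [mul_pow, Real.sq_sqrt (by positivity), euclideanNorm_sq]
  refine (sum_le_sum fun j _ => ?_).trans_eq
    (by simp : ∑ j : Fin d, supNorm d x ^ 2 = d * supNorm d x ^ 2)
  rw [← sq_abs]
  exact pow_le_pow_left₀ (abs_nonneg _) (norm_le_pi_norm x j) 2

/-- The total mean deviation of an admissible choice for each of the random permutation gaps. -/
lemma sum_meanDeviation_le (hd : 2 ≤ d) (hT : 1 ≤ T) (hN : ∀ x, N x ≤ N 1 * supNorm d x)
    (hS : S ⊆ cube d) {Q : ℝ}
    (hQ : Q = N 1 * min (Real.sqrt (T * Real.log d))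
        (Real.sqrt (maxCoord S * T * Real.log d) + Real.log d * Real.log (1 + Real.log d)) ∨
      (N = euclideanNorm d ∧ Q = N 1 * Real.sqrt (maxCoord S * T * Real.log d)))
    {w : Fin T → Vec d} (hw : ∀ i, w i ∈ cube d) (hwS : average w ∈ S) :
    ∑ t : Fin T, meanDeviation N w (Ici t) ≤ 300 * Q := by
  have hs : ∀ j, average w j ≤ maxCoord S := le_maxCoord hS hwS
  have hs0 : 0 ≤ maxCoord S := ((hS hwS).1 ⟨0, by omega⟩).trans (hs _)
  rcases hQ with rfl | ⟨rfl, rfl⟩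
  · have h1 : ∑ t : Fin T, meanDeviation N w (Ici t) ≤
        N 1 * ∑ t : Fin T, meanDeviation (supNorm d) w (Ici t) := by
      rw [mul_sum]
      exact sum_le_sum fun t _ => meanDeviation_le_mul_supNorm hN w _
    have h2 : ∑ t : Fin T, meanDeviation (supNorm d) w (Ici t) ≤
        300 * min (Real.sqrt (T * Real.log d)) (Real.sqrt (maxCoord S * T * Real.log d) +
          Real.log d * Real.log (1 + Real.log d)) := by
      rw [mul_min_of_nonneg _ _ (by norm_num : (0 : ℝ) ≤ 300)]
      exact le_min (sum_meanDeviation_supNorm_le_sqrt hd hT hw)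
        (sum_meanDeviation_supNorm_le hd hT hw hs0 hs)
    have h3 := mul_le_mul_of_nonneg_left h2 (apply_nonneg N 1)
    linarith
  · exact sum_meanDeviation_euclideanNorm_le hd hT hw hs0 hs

lemma permExp_le_of_forall_le {F : Equiv.Perm (Fin T) → ℝ} {c : ℝ} (h : ∀ π, F π ≤ c) :
    permExp F ≤ c :=
  (permExp_mono h).trans_eq (permExp_const c)

/-- The rates obtained from linear learners of regret at most `3 √(D T)`. -/
lemma exists_learners_of_isLinearLearner (hd : 2 ≤ d) (hT : 1 ≤ T)
    (hN : ∀ x, N x = 0 → x = 0) (hmono : ∀ x, N x ≤ N 1 * supNorm d x) {b C D : ℝ}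
    {base : List (Vec d) → Vec d} (hbase : IsLinearLearner N T b base)
    (hb : b ≤ 3 * Real.sqrt (D * T)) (hCD : D ≤ 2 * C) (hC : 0 ≤ C)
    (hQ : N 1 * Real.sqrt (T * Real.log d) = Real.sqrt (C * T)) (hp : IsProblem N f S L) :
    ∃ (A B : Learner d), (∀ gs, A gs ∈ dualBall N 1) ∧ (∀ gs, B gs ∈ dualBall N L) ∧
      (∀ vs : List (Vec d), vs.length = T → (∀ v ∈ vs, v ∈ cube d) →
        ocoRegret (dualBall N 1) A (vs.map (constraintPayoff S)) ≤ 1000 * Real.sqrt (D * T) ∧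
        ocoRegret (dualBall N L) B (vs.map (objectivePayoff f)) ≤
          1000 * L * Real.sqrt (D * T)) ∧
      ∀ (X : Fin T → Set (Vec d)), IsInstance S X →
      ∀ (Z : ℝ), IsTradeoff N f S X Z →
      ∀ (sel : List (Set (Vec d)) → Vec d → Vec d), IsArgmaxRule X sel →
        objectiveRegret f S L Z A B sel X ≤ (Z + L) * (1000 * Real.sqrt (C / T)) ∧
        (0 < Z + L →
          constraintRegret N f S L Z A B sel X ≤ 1000 * Real.sqrt (C / T)) := by
  have hT' : (0 : ℝ) < T := by exact_mod_cast hT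
  have hL := hp.nonneg
  have hregA : ∀ vs : List (Vec d), vs.length = T → (∀ v ∈ vs, v ∈ cube d) →
      ocoRegret (dualBall N 1) (linearized 1 base) (vs.map (constraintPayoff S)) ≤
        3 * Real.sqrt (D * T) := by
    intro vs hlen hvs
    have := hbase.ocoRegret_le hN zero_le_one (ps := vs.map (constraintPayoff S))
      (by rw [List.length_map, hlen]) (by
        simp only [List.mem_map, forall_exists_index, and_imp]
        rintro _ v hv rfl
        exact hasUnitSupergradients_constraintPayoff hp.subset_cube hp.nonempty (hvs v hv))
    linarith
  have hregB : ∀ vs : List (Vec d), vs.length = T → (∀ v ∈ vs, v ∈ cube d) →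
      ocoRegret (dualBall N L) (linearized L base) (vs.map (objectivePayoff f)) ≤
        L * (3 * Real.sqrt (D * T)) := by
    intro vs hlen hvs
    refine (hbase.ocoRegret_le hN hL (ps := vs.map (objectivePayoff f))
      (by rw [List.length_map, hlen]) (by
        simp only [List.mem_map, forall_exists_index, and_imp]
        rintro _ v hv rfl
        exact hp.hasUnitSupergradients_objectivePayoff (hvs v hv))).trans ?_
    exact mul_le_mul_of_nonneg_left hb hL
  have hA : ∀ gs, linearized 1 base gs ∈ dualBall N 1 := fun gs =>
    smul_mem_dualBall hN zero_le_one (hbase.mem _)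
  have hB : ∀ gs, linearized L base gs ∈ dualBall N L := fun gs =>
    smul_mem_dualBall hN hL (hbase.mem _)
  refine ⟨linearized 1 base, linearized L base, hA, hB, fun vs hlen hvs => ⟨?_, ?_⟩,
    fun X hX Z hZ sel hsel => ?_⟩
  · linarith [hregA vs hlen hvs, Real.sqrt_nonneg (D * T)]
  · linarith [hregB vs hlen hvs, mul_nonneg hL (Real.sqrt_nonneg (D * T))]
  · have hcube : ∀ π : Equiv.Perm (Fin T), ∀ v ∈ playsOn f S L Z (linearized 1 base)
        (linearized L base) sel X π, v ∈ cube d := fun π => by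
      rw [playsOn_eq]
      exact mem_cube_of_mem_plays hX hsel _
    set q := Real.sqrt (C / T) with hq
    have hq0 : 0 ≤ q := Real.sqrt_nonneg _
    have hCT : Real.sqrt (C * T) = T * q := by
      rw [hq, ← Real.sqrt_sq hT'.le, ← Real.sqrt_mul (sq_nonneg _), Real.sqrt_sq hT'.le]
      congr 1
      field_simp
    -- Because `D ≤ 2 C`, the regret bound `3 √(D T)` becomes at most `6 T q`. The final constants
    -- are `2 * 6 + 3 * 300 = 912`, plus `6` from the second learner.
    have hDT : Real.sqrt (D * T) ≤ 2 * (T * q) := by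
      rw [← hCT]
      apply Real.sqrt_le_iff.2 ⟨by positivity, ?_⟩
      rw [mul_pow, Real.sq_sqrt (by positivity)]
      nlinarith [mul_nonneg hC hT'.le]
    have hdev : ∀ w : Fin T → Vec d, (∀ i, w i ∈ cube d) → average w ∈ S →
        ∑ t : Fin T, meanDeviation N w (Ici t) ≤ 300 * (T * q) := by
      intro w hw _
      have h1 : ∑ t : Fin T, meanDeviation N w (Ici t) ≤
          N 1 * ∑ t : Fin T, meanDeviation (supNorm d) w (Ici t) := by
        rw [mul_sum]
        exact sum_le_sum fun t _ => meanDeviation_le_mul_supNorm hmono w _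
      have h2 := mul_le_mul_of_nonneg_left (sum_meanDeviation_supNorm_le_sqrt hd hT hw)
        (apply_nonneg N 1)
      rw [← hCT, ← hQ]
      linarith
    have hR : learnerRegretθ N f S L Z (linearized 1 base) (linearized L base) sel X ≤
        6 * (T * q) :=
      permExp_le_of_forall_le fun π =>
        (hregA _ (length_playsOn π) (hcube π)).trans (by linarith)
    have hR' : learnerRegretφ N f S L Z (linearized 1 base) (linearized L base) sel X ≤
        L * (6 * (T * q)) :=
      permExp_le_of_forall_le fun π => (hregB _ (length_playsOn π) (hcube π)).trans
        (mul_le_mul_of_nonneg_left (by linarith) hL)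
    obtain ⟨h1, h2⟩ := regret_le hN hT hp hA hB hX hZ hsel hdev hR hR'
    have hZq : 0 ≤ Z * q := mul_nonneg hZ.nonneg hq0
    have hLq : 0 ≤ L * q := mul_nonneg hL hq0
    constructor
    · refine h1.trans ?_
      have e1 : (Z + L) / T * (2 * (6 * (T * q)) + 3 * (300 * (T * q))) +
          L * (6 * (T * q)) / T = 912 * ((Z + L) * q) + 6 * (L * q) := by
        field_simp
        ring
      rw [e1]
      linarith
    · intro h0
      refine (h2 h0).trans ?_
      have e2 : 1 / T * (2 * (6 * (T * q)) + 3 * (300 * (T * q))) +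
          1 / (Z + L) * (L * (6 * (T * q)) / T) = 912 * q + 6 * (L * q) / (Z + L) := by
        field_simp
        ring
      have e3 : 6 * (L * q) / (Z + L) ≤ 6 * q := by
        rw [div_le_iff₀ h0]
        linarith
      rw [e2]
      linarith

end algorithm

end OnlineCP

end

/-- First part: the bounds through the regrets `R`, `R'` of the two learners and the random
permutation gap `Q`. Second part: the rates for the Euclidean norm and the `L_∞` norm. -/
theorem mainTheorem1 :
    ∃ K : ℝ, 0 < K ∧
      (∀ (d T : ℕ), 2 ≤ d → 1 ≤ T →
        ∀ (N : Seminorm ℝ (OnlineCP.Vec d)), (∀ x, N x = 0 → x = 0) →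
          (∀ x, N x ≤ N 1 * OnlineCP.supNorm d x) →
        ∀ (f : OnlineCP.Vec d → ℝ) (S : Set (OnlineCP.Vec d)) (L : ℝ),
          OnlineCP.IsProblem N f S L →
        ∀ (A B : OnlineCP.Learner d),
          (∀ gs, A gs ∈ OnlineCP.dualBall N 1) → (∀ gs, B gs ∈ OnlineCP.dualBall N L) →
        ∀ (X : Fin T → Set (OnlineCP.Vec d)), OnlineCP.IsInstance S X →
        ∀ (Z : ℝ), OnlineCP.IsTradeoff N f S X Z →
        ∀ (sel : List (Set (OnlineCP.Vec d)) → OnlineCP.Vec d → OnlineCP.Vec d),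
          OnlineCP.IsArgmaxRule X sel →
        ∀ (R R' : ℝ), OnlineCP.learnerRegretθ N f S L Z A B sel X ≤ R →
          OnlineCP.learnerRegretφ N f S L Z A B sel X ≤ R' →
        ∀ (Q : ℝ),
          (Q = N 1 * min (Real.sqrt (T * Real.log d))
              (Real.sqrt (OnlineCP.maxCoord S * T * Real.log d)
                + Real.log d * Real.log (1 + Real.log d)) ∨
            (N = OnlineCP.euclideanNorm d ∧
              Q = N 1 * Real.sqrt (OnlineCP.maxCoord S * T * Real.log d))) →
          OnlineCP.objectiveRegret f S L Z A B sel X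
              ≤ (Z + L) / T * (2 * R + K * Q) + R' / T ∧
          (0 < Z + L →
            OnlineCP.constraintRegret N f S L Z A B sel X
              ≤ 1 / T * (2 * R + K * Q) + 1 / (Z + L) * (R' / T))) ∧
      (∀ (d T : ℕ), 2 ≤ d → 1 ≤ T →
        ∀ (N : Seminorm ℝ (OnlineCP.Vec d)) (C D : ℝ),
          (N = OnlineCP.euclideanNorm d ∧ C = d * Real.log d ∧ D = d) ∨
            (N = OnlineCP.supNorm d ∧ C = Real.log d ∧ D = Real.log d) →
        ∀ (f : OnlineCP.Vec d → ℝ) (S : Set (OnlineCP.Vec d)) (L : ℝ),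
          OnlineCP.IsProblem N f S L →
        ∃ (A B : OnlineCP.Learner d),
          (∀ gs, A gs ∈ OnlineCP.dualBall N 1) ∧ (∀ gs, B gs ∈ OnlineCP.dualBall N L) ∧
          (∀ vs : List (OnlineCP.Vec d), vs.length = T → (∀ v ∈ vs, v ∈ OnlineCP.cube d) →
            OnlineCP.ocoRegret (OnlineCP.dualBall N 1) A
                (vs.map (OnlineCP.constraintPayoff S)) ≤ K * Real.sqrt (D * T) ∧
            OnlineCP.ocoRegret (OnlineCP.dualBall N L) B
                (vs.map (OnlineCP.objectivePayoff f)) ≤ K * L * Real.sqrt (D * T)) ∧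
          ∀ (X : Fin T → Set (OnlineCP.Vec d)), OnlineCP.IsInstance S X →
          ∀ (Z : ℝ), OnlineCP.IsTradeoff N f S X Z →
          ∀ (sel : List (Set (OnlineCP.Vec d)) → OnlineCP.Vec d → OnlineCP.Vec d),
            OnlineCP.IsArgmaxRule X sel →
            OnlineCP.objectiveRegret f S L Z A B sel X ≤ (Z + L) * (K * Real.sqrt (C / T)) ∧
            (0 < Z + L →
              OnlineCP.constraintRegret N f S L Z A B sel X ≤ K * Real.sqrt (C / T))) := by
  -- The first part needs `3 * 300 = 900`, the second `912 + 6`.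
  refine ⟨1000, by norm_num, ?_, ?_⟩
  · intro d T hd hT N hN hmono f S L hp A B hA hB X hX Z hZ sel hsel R R' hR hR' Q hQ
    have h := OnlineCP.regret_le hN hT hp hA hB hX hZ hsel
      (fun w hw hwS => OnlineCP.sum_meanDeviation_le hd hT hmono hp.subset_cube hQ hw hwS) hR hR'
    have hQ0 : 0 ≤ Q := by
      have hl := OnlineCP.half_le_log hd
      have hll : 0 ≤ Real.log (1 + Real.log d) := Real.log_nonneg (by linarith)
      have hN1 : 0 ≤ N 1 := apply_nonneg N 1
      rcases hQ with rfl | ⟨-, rfl⟩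
      · exact mul_nonneg hN1 (le_min (by positivity) (by positivity))
      · positivity
    have hT' : (0 : ℝ) < T := by exact_mod_cast hT
    have hZL : 0 ≤ Z + L := add_nonneg hZ.nonneg hp.nonneg
    refine ⟨h.1.trans ?_, fun h0 => (h.2 h0).trans ?_⟩
    · have : (Z + L) / T * (2 * R + 3 * (300 * Q)) ≤ (Z + L) / T * (2 * R + 1000 * Q) :=
        mul_le_mul_of_nonneg_left (by linarith) (by positivity)
      linarith
    · have : 1 / (T : ℝ) * (2 * R + 3 * (300 * Q)) ≤ 1 / T * (2 * R + 1000 * Q) :=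
        mul_le_mul_of_nonneg_left (by linarith) (by positivity)
      linarith
  · intro d T hd hT N C D hCD f S L hp
    have hl := OnlineCP.half_le_log hd
    rcases hCD with ⟨rfl, rfl, rfl⟩ | ⟨rfl, rfl, rfl⟩
    · obtain ⟨base, hbase⟩ := OnlineCP.exists_isLinearLearner_euclideanNorm hd hT
      refine OnlineCP.exists_learners_of_isLinearLearner hd hT OnlineCP.euclideanNorm_definite
        OnlineCP.euclideanNorm_le_mul_supNorm hbase ?_ ?_ (by positivity) ?_ hp
      · linarith [Real.sqrt_nonneg ((d : ℝ) * T)]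
      -- `d ≤ 2 d log d`, from `log d ≥ 1/2`.
      · nlinarith [(Nat.cast_nonneg d : (0 : ℝ) ≤ d)]
      · rw [OnlineCP.euclideanNorm_one, ← Real.sqrt_mul (by positivity)]
        ring_nf
    · obtain ⟨base, hbase⟩ := OnlineCP.exists_isLinearLearner_supNorm hd hT
      refine OnlineCP.exists_learners_of_isLinearLearner hd hT OnlineCP.supNorm_definite
        (fun x => ?_) hbase le_rfl (by linarith) (by linarith) ?_ hp
      · rw [OnlineCP.supNorm_one (by omega), one_mul]
      · rw [OnlineCP.supNorm_one (by omega), one_mul, mul_comm]
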